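/- Notation. For $\delta>0$ the medial lattice of mesh $\delta$ is $L_\delta=\frac{\delta}{2}\mathbb Z\times\mathbb R\subset\mathbb C$; its vertices in $\delta\mathbb Z\times\mathbb R$ are called primal, the others dual. For $p\in L_\delta$ write $p^\pm=p\pm\frac{\delta}{2}$. A medial domain of mesh $\delta$ is the bounded component of the complement of a closed self-avoiding path that consists of alternating horizontal and vertical segments with endpoints in $L_\delta$. Let $\nu=e^{-i\pi/4}$. For a mid-edge $e=[p,p^+]$, $p\in L_\delta$, let $\tau(e)=\nu$ if $p^+$ is dual and $\tau(e)=i\nu$ if $p^+$ is primal, and let $\mathrm{Proj}[X,\tau]=\frac12\big(X+\frac{\tau}{\overline\tau}\overline X\big)$. A function $F_\delta$ on the vertices of $L_\delta$ in a medial domain $\Omega_\delta$ is s-holomorphic if it is differentiable along the vertical lines, if $\mathrm{Proj}[F_\delta(p),\tau(e)]=\mathrm{Proj}[F_\delta(p^+),\tau(e)]=:F_\delta(e)$ for every mid-edge $e=[p,p^+]$ with $p,p^+\in\Omega_\delta$, and if $$\bar\partial F_\delta(p)=\frac12\Big[\frac{F_\delta(p^+)-F_\delta(p^-)}{\delta}-\frac{\partial_yF_\delta(p)}{i}\Big]=0$$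 for every vertex $p$ with $p,p^+,p^-\in\Omega_\delta$. A primitive $H_\delta=\mathrm{Im}\int F_\delta^2$ is a real function on the vertices of $L_\delta$ in $\Omega_\delta$ such that $H_\delta(p')-H_\delta(p)=\mathrm{Im}\int_p^{p'}F_\delta(z)^2\,dz$ for every vertical segment $[p,p']\subset\Omega_\delta$ of the lattice, and $H_\delta(u)-H_\delta(w)=\delta\,|F_\delta(e)|^2$ for every mid-edge $e$ with primal extremity $u\in\Omega_\delta$ and dual extremity $w\in\Omega_\delta$. Theorem. Let $\Omega\subset\mathbb C$ be open, bounded and simply connected, let $\delta_0>0$, and for $0<\delta<\delta_0$ let $\Omega_\delta\subset\Omega$ be a medial domain of mesh $\delta$, such that every compact subset of $\Omega$ is contained in $\Omega_\delta$ for all sufficiently small $\delta$. Let $Q$ be a closed non-degenerate rectangle with sides parallel to the axes such that $9Q\subset\Omega$, where $9Q$ is the rectangle with the same centre and nine times the side lengths. For $0<\delta<\delta_0$ let $F_\delta$ be an s-holomorphic function on $\Omega_\delta$ and let $H_\delta=\mathrm{Im}\int F_\delta^2$ be a primitive. Suppose that the functions $H_\delta$ are bounded on $9Q\cap\Omega_\delta$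 by a constant independent of $\delta$. Then the family $(F_\delta)$ is precompact on $Q$ in the uniform topology: for every sequence $(\delta_n)$ in $(0,\delta_0)$ with $\delta_n\to0$ there are a subsequence $(\delta_{n_j})$ and a continuous function $f:Q\to\mathbb C$ such that $$\sup_{p\in Q\cap L_{\delta_{n_j}}}|F_{\delta_{n_j}}(p)-f(p)|\longrightarrow0\qquad(j\to\infty).$$ -/

import Mathlib

open Complex Filter Topology Set
open scoped ComplexConjugate

noncomputable section

namespace SemiDiscrete

/-! Medial vertices of mesh `δ` are indexed by `(k, y) : ℤ × ℝ`; the vertex `(k, y)` is the point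
`k δ / 2 + i y` of the plane. It is primal if `k` is even and dual if `k` is odd. A function on
(a part of) the medial lattice is a function `ℤ → ℝ → ℂ` of which only the values at the vertices
under consideration matter. The mid-edge between the neighbours `(k, y)` and `(k + 1, y)` has
index `(k, y)` as well. -/

/-- The medial vertex of index `(k, y)`, as a point of the plane. -/
def pt (δ : ℝ) (k : ℤ) (y : ℝ) : ℂ := ⟨(k : ℝ) * δ / 2, y⟩

/-- The medial lattice of mesh `δ`, the union of the primal lattice `δ ℤ × ℝ` and of the dual
lattice `δ (ℤ + 1/2) × ℝ`. -/
def medialLattice (δ : ℝ) : Set ℂ := {p | ∃ (k : ℤ) (y : ℝ), p = pt δ k y}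

/-- The closed polygonal line with vertices `z 0, z 1, …, z m`. -/
def polygonalLine (m : ℕ) (z : ℕ → ℂ) : Set ℂ :=
  {p | ∃ i < m, p ∈ segment ℝ (z i) (z (i + 1))}

/-- `U` is a (open) medial domain of mesh `δ`: the bounded component of the complement of a closed
self-avoiding path on the medial lattice, made of alternating horizontal and vertical segments. -/
def IsMedialDomain (δ : ℝ) (U : Set ℂ) : Prop :=
  ∃ (n : ℕ) (z : ℕ → ℂ), 0 < n ∧ z (2 * n) = z 0 ∧
    (∀ i, z i ∈ medialLattice δ) ∧
    (∀ i < n, (z (2 * i)).im = (z (2 * i + 1)).im) ∧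
    (∀ i < n, (z (2 * i + 1)).re = (z (2 * i + 2)).re) ∧
    Set.InjOn z {i | i < 2 * n} ∧
    (∀ i < 2 * n, ∀ j < 2 * n, i ≠ j →
      segment ℝ (z i) (z (i + 1)) ∩ segment ℝ (z j) (z (j + 1)) ⊆
        {z i, z (i + 1)} ∩ {z j, z (j + 1)}) ∧
    U = {p | p ∉ polygonalLine (2 * n) z ∧
      Bornology.IsBounded (connectedComponentIn (polygonalLine (2 * n) z)ᶜ p)}

/-- A continuum domain: an open, bounded and simply connected subset of the plane. -/
structure IsPlanarDomain (Ω : Set ℂ) : Prop where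
  isOpen : IsOpen Ω
  isBounded : Bornology.IsBounded Ω
  simplyConnected : SimplyConnectedSpace Ω

/-- `(D δ)`, `0 < δ < δ₀`, are semi-discrete approximations of `Ω`: medial domains of mesh `δ`
inside `Ω` which converge to `Ω` in the sense that they exhaust its compact subsets as `δ → 0`.
(There is a bound on `δ` since a bounded `Ω` contains no medial domain of large mesh.) -/
structure IsSemiDiscretization (Ω : Set ℂ) (δ₀ : ℝ) (D : ℝ → Set ℂ) : Prop where
  isMedialDomain : ∀ δ, 0 < δ → δ < δ₀ → IsMedialDomain δ (D δ)
  subset : ∀ δ, 0 < δ → δ < δ₀ → D δ ⊆ Ω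
  exhausts : ∀ K ⊆ Ω, IsCompact K → ∀ᶠ δ in 𝓝[>] (0 : ℝ), K ⊆ D δ

/-- `ν = exp (- i π / 4)`. -/
def nu : ℂ := Complex.exp (-(I * (Real.pi : ℂ) / 4))

/-- The direction `τ(e) ∥ [i (w_e - u_e)]^{-1/2}` of the mid-edge `e` between the columns `k` and
`k + 1`, where `u_e` is its primal and `w_e` its dual extremity: it is `ν` if the right extremity is
dual, and `i ν` if the right extremity is primal. -/
def tau (k : ℤ) : ℂ := if Even k then nu else I * nu

/-- The projection of `X` in the direction `τ`. -/
def proj (X τ : ℂ) : ℂ := (X + τ / conj τ * conj X) / 2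

/-- The semi-discrete anti-derivative
`∂̄ F (p) = ½ [(F(p⁺) - F(p⁻)) / δ - ∂_y F(p) / i]`, where `p^± = p ± δ/2`. -/
def dbar (δ : ℝ) (F : ℤ → ℝ → ℂ) (k : ℤ) (y : ℝ) : ℂ :=
  ((F (k + 1) y - F (k - 1) y) / (δ : ℂ) - deriv (F k) y / I) / 2

/-- `F` is s-holomorphic on the medial vertices in `U`. -/
structure IsSHolomorphic (δ : ℝ) (U : Set ℂ) (F : ℤ → ℝ → ℂ) : Prop where
  /-- `F` is differentiable along the vertical lines -/
  differentiable : ∀ k y, pt δ k y ∈ U → DifferentiableAt ℝ (F k) y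
  /-- the two extremities of each mid-edge have the same projection on `τ(e)` -/
  projection : ∀ k y, pt δ k y ∈ U → pt δ (k + 1) y ∈ U →
    proj (F k y) (tau k) = proj (F (k + 1) y) (tau k)
  /-- `∂̄ F = 0` at each vertex `p` of the interior, i.e. such that `p`, `p⁺` and `p⁻` are in `U` -/
  holomorphic : ∀ k y, pt δ k y ∈ U → pt δ (k + 1) y ∈ U → pt δ (k - 1) y ∈ U →
    dbar δ F k y = 0

/-- The value of the s-holomorphic function `F` at the mid-edge between `(k, y)` and `(k + 1, y)`,
namely the common projection of the values at the two extremities. -/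
def midEdge (F : ℤ → ℝ → ℂ) (k : ℤ) (y : ℝ) : ℂ := proj (F k y) (tau k)

/-- `H` is a primitive `Im ∫ F²` on the medial vertices in `U`. -/
structure IsPrimitive (δ : ℝ) (U : Set ℂ) (F : ℤ → ℝ → ℂ) (H : ℤ → ℝ → ℝ) : Prop where
  /-- `H(p') - H(p) = Im ∫_p^{p'} F(z)² dz` along each vertical segment in `U`, with `dz = i dy` -/
  vertical : ∀ k y y', y ≤ y' → (∀ t ∈ Set.Icc y y', pt δ k t ∈ U) →
    H k y' - H k y = (∫ t in y..y', I * F k t ^ 2).im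
  /-- `H(b) - H(w) = δ |F(bw)|²` if `b` is primal and its right neighbour `w` is dual -/
  edge_primal_dual : ∀ k y, Even k → pt δ k y ∈ U → pt δ (k + 1) y ∈ U →
    H k y - H (k + 1) y = δ * ‖midEdge F k y‖ ^ 2
  /-- `H(b) - H(w) = δ |F(bw)|²` if `w` is dual and its right neighbour `b` is primal -/
  edge_dual_primal : ∀ k y, ¬ Even k → pt δ k y ∈ U → pt δ (k + 1) y ∈ U →
    H (k + 1) y - H k y = δ * ‖midEdge F k y‖ ^ 2

/-- The closed rectangle of centre `c` and half-sides `a`, `b`, parallel to the axes. -/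
def rect (c : ℂ) (a b : ℝ) : Set ℂ := {z | |z.re - c.re| ≤ a ∧ |z.im - c.im| ≤ b}

/-- The functions `F δ`, `0 < δ < δ₀`, on the medial lattices of mesh `δ` are precompact on `K` for
the uniform topology: along every sequence of meshes tending to `0` there is a subsequence which
converges uniformly on `K` to a continuous function. -/
def PrecompactOn (δ₀ : ℝ) (F : ℝ → ℤ → ℝ → ℂ) (K : Set ℂ) : Prop :=
  ∀ s : ℕ → ℝ, (∀ n, 0 < s n ∧ s n < δ₀) → Tendsto s atTop (𝓝 0) →
    ∃ (φ : ℕ → ℕ) (f : ℂ → ℂ), StrictMono φ ∧ ContinuousOn f K ∧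
      ∀ ε > 0, ∀ᶠ n in atTop, ∀ (k : ℤ) (y : ℝ), pt (s (φ n)) k y ∈ K →
        ‖F (s (φ n)) k y - f (pt (s (φ n)) k y)‖ < ε

end SemiDiscrete

end

/-! The values of an s-holomorphic `F` at mid-edges are encoded by one real function `g = obs F`.
Adjacent mid-edges carry orthogonal projections of `F`, so `g` determines `F`. The equation `∂̄F =
0` becomes the first-order system `∂_y g = twist g`, and `twist` applied twice is minus the
horizontal second difference between columns two apart. Hence `g` is harmonic for the semi-discrete
Laplacian, and so is `twist g`, which solves the same system.

The primitive enters through `u = B - sgn * H`, which is `B + H` on primal columns and `B - H` on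
dual ones. The system makes its Laplacian a sum of squares, so `u` is subharmonic; if `|H| ≤ B`, it
also lies between `0` and `2B`. Caccioppoli's inequality (`caccioppoli`) needs only `u Δu ≥ 0`, and
bounds the gradient of `u` in `L²`. The components of this gradient are the products and the
differences of squares of neighbouring values of `g`, so together they control `g⁴` and hence the
energy of `g` (`energy_le_of_primitive`).

Caccioppoli's inequality applies again to `g` and its iterated twists, where `g Δg = 0`. With
one-dimensional Sobolev inequalities in each direction it turns the energy into pointwise bounds on
`g` and `twist g` (`sq_apply_zero_le`, `bounds_at_centre`). At a scale comparable to the rectangle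
these do not depend on the mesh (`exists_obs_bound`). They bound `F` and its Lipschitz constant;
Lipschitz extension off the lattice and Arzelà–Ascoli conclude. -/

namespace SemiDiscrete

/-! ### Energy estimates on one vertical line -/

/-- Green's identity on an interval for `u²`, against the cutoff `(R² - y²)²`. -/
theorem integral_cutoff {u v w : ℝ → ℝ} {R : ℝ} (hR : 0 ≤ R)
    (hu : ∀ y, |y| ≤ R → HasDerivAt u (v y) y) (hv : ∀ y, |y| ≤ R → HasDerivAt v (w y) y)
    (hw : ContinuousOn w (Icc (-R) R)) :
    ∫ y in -R..R, (R ^ 2 - y ^ 2) ^ 2 * (2 * v y ^ 2 + 2 * u y * w y)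
      = ∫ y in -R..R, (12 * y ^ 2 - 4 * R ^ 2) * u y ^ 2 := by
  have hle : -R ≤ R := by linarith
  have hcu : ContinuousOn u (Icc (-R) R) := fun y hy =>
    (hu y (abs_le.2 hy)).continuousAt.continuousWithinAt
  have hcv : ContinuousOn v (Icc (-R) R) := fun y hy =>
    (hv y (abs_le.2 hy)).continuousAt.continuousWithinAt
  have i1 : IntervalIntegrable (fun y => (R ^ 2 - y ^ 2) ^ 2 * (2 * v y ^ 2 + 2 * u y * w y))
      MeasureTheory.volume (-R) R := by
    apply ContinuousOn.intervalIntegrable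
    rw [uIcc_of_le hle]
    fun_prop
  have i2 : IntervalIntegrable (fun y => (12 * y ^ 2 - 4 * R ^ 2) * u y ^ 2)
      MeasureTheory.volume (-R) R := by
    apply ContinuousOn.intervalIntegrable
    rw [uIcc_of_le hle]
    fun_prop
  have key : ∫ y in -R..R, ((R ^ 2 - y ^ 2) ^ 2 * (2 * v y ^ 2 + 2 * u y * w y)
      - (12 * y ^ 2 - 4 * R ^ 2) * u y ^ 2)
      = ((R ^ 2 - R ^ 2) ^ 2 * (2 * u R * v R) + 4 * R * (R ^ 2 - R ^ 2) * u R ^ 2)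
        - ((R ^ 2 - (-R) ^ 2) ^ 2 * (2 * u (-R) * v (-R))
          + 4 * (-R) * (R ^ 2 - (-R) ^ 2) * u (-R) ^ 2) := by
    -- With `φ = (R² - y²)²` the antiderivative is `φ (u²)' - φ' u²`. It vanishes at `±R`, where `φ`
    -- has double zeros.
    refine intervalIntegral.integral_eq_sub_of_hasDerivAt
      (f := fun y => (R ^ 2 - y ^ 2) ^ 2 * (2 * u y * v y) + 4 * y * (R ^ 2 - y ^ 2) * u y ^ 2)
      ?_ (i1.sub i2)
    intro y hy
    rw [uIcc_of_le hle] at hy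
    have h1 := hu y (abs_le.2 hy)
    have h2 := hv y (abs_le.2 hy)
    have h3 : HasDerivAt (fun y : ℝ => R ^ 2 - y ^ 2) (-(2 * y)) y := by
      simpa using ((hasDerivAt_pow 2 y).const_sub (R ^ 2))
    have h4 := ((h3.pow 2).mul ((h1.const_mul 2).mul h2)).add
      ((((hasDerivAt_id y).const_mul 4).mul h3).mul (h1.pow 2))
    refine h4.congr_deriv ?_
    simp
    ring
  rw [intervalIntegral.integral_sub i1 i2] at key
  have : ((R ^ 2 - R ^ 2) ^ 2 * (2 * u R * v R) + 4 * R * (R ^ 2 - R ^ 2) * u R ^ 2)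
        - ((R ^ 2 - (-R) ^ 2) ^ 2 * (2 * u (-R) * v (-R))
          + 4 * (-R) * (R ^ 2 - (-R) ^ 2) * u (-R) ^ 2) = 0 := by ring
  linarith

/-- The energy inequality on a vertical line, `p` and `q` being the values on the neighbouring
lines. -/
theorem line_energy_le {u v w p q : ℝ → ℝ} {R δ : ℝ} (hR : 0 ≤ R) (hδ : 0 < δ)
    (hu : ∀ y, |y| ≤ R → HasDerivAt u (v y) y) (hv : ∀ y, |y| ≤ R → HasDerivAt v (w y) y)
    (hw : ContinuousOn w (Icc (-R) R)) (hp : ContinuousOn p (Icc (-R) R))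
    (hq : ContinuousOn q (Icc (-R) R))
    (hsub : ∀ y, |y| ≤ R → 0 ≤ u y * (w y + (p y - 2 * u y + q y) / δ ^ 2)) :
    ∫ y in -R..R, (R ^ 2 - y ^ 2) ^ 2 * (2 * v y ^ 2 + (p y - u y) ^ 2 / δ ^ 2)
      ≤ 8 * R ^ 2 * (∫ y in -R..R, u y ^ 2)
        + ((∫ y in -R..R, (R ^ 2 - y ^ 2) ^ 2 * p y ^ 2)
          - 2 * (∫ y in -R..R, (R ^ 2 - y ^ 2) ^ 2 * u y ^ 2)
          + ∫ y in -R..R, (R ^ 2 - y ^ 2) ^ 2 * q y ^ 2) / δ ^ 2 := by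
  have hle : -R ≤ R := by linarith
  have hcu : ContinuousOn u (Icc (-R) R) := fun y hy =>
    (hu y (abs_le.2 hy)).continuousAt.continuousWithinAt
  have hcv : ContinuousOn v (Icc (-R) R) := fun y hy =>
    (hv y (abs_le.2 hy)).continuousAt.continuousWithinAt
  have int : ∀ f : ℝ → ℝ, ContinuousOn f (Icc (-R) R) →
      IntervalIntegrable f MeasureTheory.volume (-R) R := by
    intro f hf
    apply ContinuousOn.intervalIntegrable
    rwa [uIcc_of_le hle]
  have i1 := int (fun y => (R ^ 2 - y ^ 2) ^ 2 * (2 * v y ^ 2 + 2 * u y * w y)) (by fun_prop)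
  have i2 := int (fun y => (R ^ 2 - y ^ 2) ^ 2 * p y ^ 2) (by fun_prop)
  have i3 := int (fun y => (R ^ 2 - y ^ 2) ^ 2 * u y ^ 2) (by fun_prop)
  have i4 := int (fun y => (R ^ 2 - y ^ 2) ^ 2 * q y ^ 2) (by fun_prop)
  have i5 := int (fun y => (R ^ 2 - y ^ 2) ^ 2 * (2 * v y ^ 2 + (p y - u y) ^ 2 / δ ^ 2))
    (by fun_prop)
  have i6 := int (fun y => (12 * y ^ 2 - 4 * R ^ 2) * u y ^ 2) (by fun_prop)
  have i7 := int (fun y => 8 * R ^ 2 * u y ^ 2) (by fun_prop)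
  have e1 : ∫ y in -R..R, (12 * y ^ 2 - 4 * R ^ 2) * u y ^ 2
      ≤ 8 * R ^ 2 * ∫ y in -R..R, u y ^ 2 := by
    rw [← intervalIntegral.integral_const_mul]
    refine intervalIntegral.integral_mono_on hle i6 i7 fun y hy => ?_
    have : y ^ 2 ≤ R ^ 2 := sq_le_sq' hy.1 hy.2
    nlinarith [sq_nonneg (u y)]
  have e2 : ∫ y in -R..R, (R ^ 2 - y ^ 2) ^ 2 * (2 * v y ^ 2 + (p y - u y) ^ 2 / δ ^ 2)
      ≤ ∫ y in -R..R, ((R ^ 2 - y ^ 2) ^ 2 * (2 * v y ^ 2 + 2 * u y * w y)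
        + ((R ^ 2 - y ^ 2) ^ 2 * p y ^ 2 - 2 * ((R ^ 2 - y ^ 2) ^ 2 * u y ^ 2)
          + (R ^ 2 - y ^ 2) ^ 2 * q y ^ 2) / δ ^ 2) := by
    refine intervalIntegral.integral_mono_on hle i5
      (i1.add (((i2.sub (i3.const_mul 2)).add i4).div_const _)) fun y hy => ?_
    have h := hsub y (abs_le.2 hy)
    -- Discrete Leibniz rule: `p² - 2u² + q² = (p - u)² + (u - q)² + 2u(p - 2u + q)`. The backward
    -- difference and the term `u Δu` are nonnegative and are dropped.
    have h' : (R ^ 2 - y ^ 2) ^ 2 * (2 * v y ^ 2 + (p y - u y) ^ 2 / δ ^ 2)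
        + (R ^ 2 - y ^ 2) ^ 2 * ((u y - q y) ^ 2 / δ ^ 2)
        + (R ^ 2 - y ^ 2) ^ 2 * (2 * (u y * (w y + (p y - 2 * u y + q y) / δ ^ 2)))
        = (R ^ 2 - y ^ 2) ^ 2 * (2 * v y ^ 2 + 2 * u y * w y)
        + ((R ^ 2 - y ^ 2) ^ 2 * p y ^ 2 - 2 * ((R ^ 2 - y ^ 2) ^ 2 * u y ^ 2)
          + (R ^ 2 - y ^ 2) ^ 2 * q y ^ 2) / δ ^ 2 := by
      field_simp
      ring
    rw [← h']
    have p1 : 0 ≤ (R ^ 2 - y ^ 2) ^ 2 * ((u y - q y) ^ 2 / δ ^ 2) := by positivity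
    have p2 : 0 ≤ (R ^ 2 - y ^ 2) ^ 2 *
        (2 * (u y * (w y + (p y - 2 * u y + q y) / δ ^ 2))) := by positivity
    linarith
  rw [intervalIntegral.integral_add i1 (((i2.sub (i3.const_mul 2)).add i4).div_const _),
    intervalIntegral.integral_div, intervalIntegral.integral_add (i2.sub (i3.const_mul 2)) i4,
    intervalIntegral.integral_sub i2 (i3.const_mul 2), intervalIntegral.integral_const_mul,
    integral_cutoff hR hu hv hw] at e2
  linarith

/-! ### Horizontal cutoff and summation by parts -/

/-- The horizontal cutoff. -/
def tent (N k : ℤ) : ℝ := ((max (N - |k|) 0 : ℤ) : ℝ) ^ 2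

theorem tent_eq_zero {N k : ℤ} (h : N ≤ |k|) : tent N k = 0 := by
  simp [tent, max_eq_right (sub_nonpos.2 h)]

theorem tent_nonneg (N k : ℤ) : 0 ≤ tent N k := sq_nonneg _

theorem tent_le {N k : ℤ} (hN : 0 ≤ N) : tent N k ≤ (N : ℝ) ^ 2 := by
  have h1 : max (N - |k|) 0 ≤ N := max_le (by have := abs_nonneg k; omega) hN
  have h2 : 0 ≤ max (N - |k|) 0 := le_max_right _ _
  unfold tent
  exact_mod_cast pow_le_pow_left₀ h2 h1 2

theorem le_tent {m k : ℤ} (hm : 0 ≤ m) (hk : |k| ≤ m) : (m : ℝ) ^ 2 ≤ tent (2 * m) k := by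
  have h1 : m ≤ max (2 * m - |k|) 0 := le_max_of_le_left (by omega)
  unfold tent
  exact_mod_cast pow_le_pow_left₀ hm h1 2

/-- A square has second difference `2 · 2² = 8` at step `2`. The kink at `k = 0` is concave and only
lowers it; near the edge of the support the truncation is checked separately. -/
theorem tent_second_difference_le (N k : ℤ) :
    tent N (k + 2) - 2 * tent N k + tent N (k - 2) ≤ 8 := by
  have key : (max (N - |k + 2|) 0) ^ 2 - 2 * (max (N - |k|) 0) ^ 2 + (max (N - |k - 2|) 0) ^ 2
      ≤ 8 := by
    rcases le_total 0 k with hk | hk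
    · rw [abs_of_nonneg hk, abs_of_nonneg (by omega : (0 : ℤ) ≤ k + 2)]
      rcases le_total k N with h | h
      · have a1 : max (N - |k - 2|) 0 ≤ N - k + 2 := max_le (by
          have := le_abs_self (k - 2); omega) (by omega)
        have a2 : (max (N - |k - 2|) 0) ^ 2 ≤ (N - k + 2) ^ 2 :=
          pow_le_pow_left₀ (le_max_right _ _) a1 2
        have a3 : (max (N - (k + 2)) 0) ^ 2 ≤ (N - k - 2) ^ 2 := by
          rcases le_total (N - (k + 2)) 0 with h' | h'
          · rw [max_eq_right h']; positivity
          · rw [max_eq_left h']; apply le_of_eq; ring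
        rw [max_eq_left (by omega : 0 ≤ N - k)]
        nlinarith
      · rw [max_eq_right (by omega : N - k ≤ 0), max_eq_right (by omega : N - (k + 2) ≤ 0)]
        have a1 : max (N - |k - 2|) 0 ≤ 2 := max_le (by
          have := le_abs_self (k - 2); omega) (by omega)
        have a2 : (max (N - |k - 2|) 0) ^ 2 ≤ 2 ^ 2 :=
          pow_le_pow_left₀ (le_max_right _ _) a1 2
        omega
    · rw [abs_of_nonpos hk, abs_of_nonpos (by omega : k - 2 ≤ 0)]
      rcases le_total (-k) N with h | h
      · have a1 : max (N - |k + 2|) 0 ≤ N + k + 2 := max_le (by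
          have := neg_le_abs (k + 2); omega) (by omega)
        have a2 : (max (N - |k + 2|) 0) ^ 2 ≤ (N + k + 2) ^ 2 :=
          pow_le_pow_left₀ (le_max_right _ _) a1 2
        have a3 : (max (N - -(k - 2)) 0) ^ 2 ≤ (N + k - 2) ^ 2 := by
          rcases le_total (N - -(k - 2)) 0 with h' | h'
          · rw [max_eq_right h']; positivity
          · rw [max_eq_left h']; apply le_of_eq; ring
        rw [max_eq_left (by omega : 0 ≤ N - -k)]
        nlinarith
      · rw [max_eq_right (by omega : N - -k ≤ 0), max_eq_right (by omega : N - -(k - 2) ≤ 0)]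
        have a1 : max (N - |k + 2|) 0 ≤ 2 := max_le (by
          have := neg_le_abs (k + 2); omega) (by omega)
        have a2 : (max (N - |k + 2|) 0) ^ 2 ≤ 2 ^ 2 :=
          pow_le_pow_left₀ (le_max_right _ _) a1 2
        omega
  unfold tent
  exact_mod_cast key

theorem sum_Icc_add_int (f : ℤ → ℝ) (a b c : ℤ) :
    ∑ k ∈ Finset.Icc a b, f (k + c) = ∑ k ∈ Finset.Icc (a + c) (b + c), f k := by
  rw [← Finset.map_add_right_Icc, Finset.sum_map]
  rfl

/-- A sum whose terms vanish off a smaller interval of integers. -/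
theorem sum_Icc_eq_of_eq_zero {f : ℤ → ℝ} {a b a' b' : ℤ} (ha : a' ≤ a) (hb : b ≤ b')
    (hf : ∀ k, k < a ∨ b < k → f k = 0) :
    ∑ k ∈ Finset.Icc a b, f k = ∑ k ∈ Finset.Icc a' b', f k := by
  refine Finset.sum_subset (Finset.Icc_subset_Icc ha hb) fun k _ hk => hf k ?_
  rw [Finset.mem_Icc] at hk
  omega

/-- Summation by parts moves the second difference onto the cutoff. Its translates by `±2` vanish
outside `|k| ≤ N + 1`, hence the slightly larger range on the right. -/
theorem sum_tent_mul_le {W : ℤ → ℝ} (hW : ∀ k, 0 ≤ W k) (N : ℤ) :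
    ∑ k ∈ Finset.Icc (-N) N, tent N k * (W (k + 2) - 2 * W k + W (k - 2))
      ≤ 8 * ∑ k ∈ Finset.Icc (-(N + 1)) (N + 1), W k := by
  have z : ∀ j, N ≤ |j| → tent N j = 0 := fun j hj => tent_eq_zero hj
  have e1 : ∑ k ∈ Finset.Icc (-N) N, tent N k * W (k + 2)
      = ∑ k ∈ Finset.Icc (-(N + 1)) (N + 1), tent N (k - 2) * W k := by
    have := sum_Icc_add_int (fun k => tent N (k - 2) * W k) (-N) N 2
    simp only [add_sub_cancel_right] at this
    rw [this]
    have h1 := sum_Icc_eq_of_eq_zero (f := fun k => tent N (k - 2) * W k) (a := -N + 2)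
      (b := N + 2) (a' := -N - 2) (b' := N + 2) (by omega) le_rfl (fun k hk => by
        rw [z _ (by rcases hk with h | h <;> rw [le_abs] <;> omega), zero_mul])
    have h2 := sum_Icc_eq_of_eq_zero (f := fun k => tent N (k - 2) * W k) (a := -(N + 1))
      (b := N + 1) (a' := -N - 2) (b' := N + 2) (by omega) (by omega) (fun k hk => by
        rw [z _ (by rcases hk with h | h <;> rw [le_abs] <;> omega), zero_mul])
    rw [h1, h2]
  have e2 : ∑ k ∈ Finset.Icc (-N) N, tent N k * W (k - 2)
      = ∑ k ∈ Finset.Icc (-(N + 1)) (N + 1), tent N (k + 2) * W k := by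
    have := sum_Icc_add_int (fun k => tent N (k + 2) * W k) (-N) N (-2)
    simp only [← sub_eq_add_neg, sub_add_cancel] at this
    rw [this]
    have h1 := sum_Icc_eq_of_eq_zero (f := fun k => tent N (k + 2) * W k) (a := -N - 2)
      (b := N - 2) (a' := -N - 2) (b' := N + 2) (by omega) (by omega) (fun k hk => by
        rw [z _ (by rcases hk with h | h <;> rw [le_abs] <;> omega), zero_mul])
    have h2 := sum_Icc_eq_of_eq_zero (f := fun k => tent N (k + 2) * W k) (a := -(N + 1))
      (b := N + 1) (a' := -N - 2) (b' := N + 2) (by omega) (by omega) (fun k hk => by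
        rw [z _ (by rcases hk with h | h <;> rw [le_abs] <;> omega), zero_mul])
    rw [h1, h2]
  have e3 : ∑ k ∈ Finset.Icc (-N) N, tent N k * W k
      = ∑ k ∈ Finset.Icc (-(N + 1)) (N + 1), tent N k * W k :=
    sum_Icc_eq_of_eq_zero (by omega) (by omega) (fun k hk => by
        rw [z _ (by rcases hk with h | h <;> rw [le_abs] <;> omega), zero_mul])
  calc ∑ k ∈ Finset.Icc (-N) N, tent N k * (W (k + 2) - 2 * W k + W (k - 2))
      = ∑ k ∈ Finset.Icc (-N) N, tent N k * W (k + 2)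
        - 2 * ∑ k ∈ Finset.Icc (-N) N, tent N k * W k
        + ∑ k ∈ Finset.Icc (-N) N, tent N k * W (k - 2) := by
        rw [Finset.mul_sum, ← Finset.sum_sub_distrib, ← Finset.sum_add_distrib]
        exact Finset.sum_congr rfl fun k _ => by ring
    _ = ∑ k ∈ Finset.Icc (-(N + 1)) (N + 1),
          (tent N (k + 2) - 2 * tent N k + tent N (k - 2)) * W k := by
        rw [e1, e2, e3, Finset.mul_sum, ← Finset.sum_sub_distrib, ← Finset.sum_add_distrib]
        exact Finset.sum_congr rfl fun k _ => by ring
    _ ≤ ∑ k ∈ Finset.Icc (-(N + 1)) (N + 1), 8 * W k :=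
        Finset.sum_le_sum fun k _ =>
          mul_le_mul_of_nonneg_right (tent_second_difference_le N k) (hW k)
    _ = _ := by rw [Finset.mul_sum]

/-! ### Sobolev on a line, energy on boxes, Caccioppoli's inequality -/

/-- Sobolev's inequality on an interval. -/
theorem line_sobolev {g g' : ℝ → ℝ} {R : ℝ} (hR : 0 ≤ R)
    (hg : ∀ y, |y| ≤ R → HasDerivAt g (g' y) y) (hg' : ContinuousOn g' (Icc (-R) R)) :
    R * g 0 ^ 2 ≤ 2 * (∫ y in -R..R, g y ^ 2) + R ^ 2 * ∫ y in -R..R, g' y ^ 2 := by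
  have hc : ContinuousOn g (Icc (-R) R) := fun y hy =>
    (hg y (abs_le.2 hy)).continuousAt.continuousWithinAt
  have sub : Icc 0 R ⊆ Icc (-R) R := Icc_subset_Icc_left (by linarith)
  have int : ∀ a, -R ≤ a → a ≤ R → ∀ f : ℝ → ℝ, ContinuousOn f (Icc (-R) R) →
      IntervalIntegrable f MeasureTheory.volume a R := by
    intro a ha hb f hf
    apply ContinuousOn.intervalIntegrable
    rw [uIcc_of_le hb]
    exact hf.mono (Icc_subset_Icc_left ha)
  have mono : ∀ f : ℝ → ℝ, ContinuousOn f (Icc (-R) R) →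
      ∫ y in 0..R, f y ^ 2 ≤ ∫ y in -R..R, f y ^ 2 := by
    intro f hf
    exact intervalIntegral.integral_mono_interval (by linarith) hR le_rfl
      (Eventually.of_forall fun y => sq_nonneg (f y))
      (int (-R) le_rfl (by linarith) (fun y => f y ^ 2) (by fun_prop))
  -- The weight `R - y` vanishes at `R`, so the only boundary term is the one at `0`.
  have key : ∫ y in 0..R, (-(g y ^ 2) + (R - y) * (2 * g y * g' y))
      = (R - R) * g R ^ 2 - (R - 0) * g 0 ^ 2 := by
    refine intervalIntegral.integral_eq_sub_of_hasDerivAt (f := fun y => (R - y) * g y ^ 2) ?_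
      (int 0 (by linarith) hR _ (by fun_prop))
    intro y hy
    rw [uIcc_of_le hR] at hy
    have h1 := hg y (abs_le.2 (sub hy))
    have h2 := ((hasDerivAt_id y).const_sub R).mul (h1.pow 2)
    refine h2.congr_deriv ?_
    simp
  have bound : ∫ y in 0..R, (-(2 * g y ^ 2 + R ^ 2 * g' y ^ 2))
      ≤ ∫ y in 0..R, (-(g y ^ 2) + (R - y) * (2 * g y * g' y)) := by
    refine intervalIntegral.integral_mono_on hR (int 0 (by linarith) hR _ (by fun_prop))
      (int 0 (by linarith) hR _ (by fun_prop)) fun y hy => ?_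
    have h1 : 0 ≤ (g y + (R - y) * g' y) ^ 2 := sq_nonneg _
    have h2 : (R - y) ^ 2 ≤ R ^ 2 := pow_le_pow_left₀ (by linarith [hy.2]) (by linarith [hy.1]) 2
    have h3 := mul_le_mul_of_nonneg_right h2 (sq_nonneg (g' y))
    nlinarith
  have i1 := int 0 (by linarith) hR (fun y => 2 * g y ^ 2) (by fun_prop)
  have i2 := int 0 (by linarith) hR (fun y => R ^ 2 * g' y ^ 2) (by fun_prop)
  rw [intervalIntegral.integral_neg, intervalIntegral.integral_add i1 i2,
    intervalIntegral.integral_const_mul, intervalIntegral.integral_const_mul, key] at bound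
  have m1 := mono g hc
  have m2 := mul_le_mul_of_nonneg_left (mono g' hg') (sq_nonneg R)
  nlinarith

/-- The `ℓ²L²` norm, squared, on the box of `2 m + 1` columns of half-height `m δ`. -/
noncomputable def energy (δ : ℝ) (m : ℕ) (g : ℤ → ℝ → ℝ) : ℝ :=
  ∑ k ∈ Finset.Icc (-(m : ℤ)) m, ∫ y in -(m * δ)..(m * δ), g k y ^ 2

theorem mem_Icc_neg_iff {m k : ℤ} : k ∈ Finset.Icc (-m) m ↔ |k| ≤ m := by
  rw [Finset.mem_Icc, abs_le]

theorem integral_le_integral_of_nonneg {f : ℝ → ℝ} {r R : ℝ} (hr : 0 ≤ r) (hrR : r ≤ R)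
    (hf : ∀ y, 0 ≤ f y) (hc : ContinuousOn f (Icc (-R) R)) :
    ∫ y in -r..r, f y ≤ ∫ y in -R..R, f y := by
  refine intervalIntegral.integral_mono_interval (by linarith) (by linarith) hrR
    (Eventually.of_forall hf) (ContinuousOn.intervalIntegrable ?_)
  rwa [uIcc_of_le (by linarith)]

theorem integral_nonneg_of_sq {f : ℝ → ℝ} {R : ℝ} (hR : 0 ≤ R) (hf : ∀ y, 0 ≤ f y) :
    0 ≤ ∫ y in -R..R, f y :=
  intervalIntegral.integral_nonneg (by linarith) fun y _ => hf y

theorem energy_mono {δ : ℝ} (hδ : 0 < δ) {m n : ℕ} (hmn : m ≤ n) {g : ℤ → ℝ → ℝ}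
    (hg : ∀ k : ℤ, |k| ≤ n → ∀ y, |y| ≤ n * δ → ContinuousAt (g k) y) :
    energy δ m g ≤ energy δ n g := by
  have hmn' : (m : ℤ) ≤ n := by exact_mod_cast hmn
  have hmn'' : (m : ℝ) ≤ n := by exact_mod_cast hmn
  have h1 : energy δ m g ≤ ∑ k ∈ Finset.Icc (-(m : ℤ)) m, ∫ y in -(n * δ)..(n * δ), g k y ^ 2 := by
    refine Finset.sum_le_sum fun k hk => ?_
    rw [mem_Icc_neg_iff] at hk
    refine integral_le_integral_of_nonneg (by positivity) (by gcongr) (fun y => sq_nonneg _) ?_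
    have : ContinuousOn (g k) (Icc (-(n * δ)) (n * δ)) := fun y hy =>
      (hg k (hk.trans hmn') y (abs_le.2 hy)).continuousWithinAt
    fun_prop
  refine h1.trans (Finset.sum_le_sum_of_subset_of_nonneg
    (Finset.Icc_subset_Icc (by omega) hmn') fun k _ _ => ?_)
  exact integral_nonneg_of_sq (by positivity) fun y => sq_nonneg _

/-- Caccioppoli's inequality for functions `u` with `u Δ u ≥ 0`. -/
theorem caccioppoli {δ : ℝ} (hδ : 0 < δ) {m : ℕ} (hm : 1 ≤ m) {u v w : ℤ → ℝ → ℝ}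
    (hu : ∀ k : ℤ, |k| ≤ 4 * m → ∀ y, |y| ≤ 4 * m * δ → HasDerivAt (u k) (v k y) y)
    (hv : ∀ k : ℤ, |k| ≤ 2 * m → ∀ y, |y| ≤ 4 * m * δ → HasDerivAt (v k) (w k y) y)
    (hw : ∀ k : ℤ, |k| ≤ 2 * m → ∀ y, |y| ≤ 4 * m * δ → ContinuousAt (w k) y)
    (hsub : ∀ k : ℤ, |k| ≤ 2 * m → ∀ y, |y| ≤ 4 * m * δ →
      0 ≤ u k y * (w k y + (u (k + 2) y - 2 * u k y + u (k - 2) y) / δ ^ 2)) :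
    (m * δ) ^ 2 * ∑ k ∈ Finset.Icc (-(m : ℤ)) m,
        ∫ y in -(m * δ)..(m * δ), (2 * v k y ^ 2 + (u (k + 2) y - u k y) ^ 2 / δ ^ 2)
      ≤ 32 * energy δ (4 * m) u := by
  have hm0 : (0 : ℝ) < m := by exact_mod_cast hm
  obtain ⟨R, hR⟩ : ∃ R : ℝ, R = 2 * (m * δ) := ⟨_, rfl⟩
  have hmδ : 0 < m * δ := by positivity
  have hR0 : 0 ≤ R := by linarith
  have hR4 : R ≤ 4 * m * δ := by linarith
  have cu : ∀ k : ℤ, |k| ≤ 4 * m → ContinuousOn (u k) (Icc (-R) R) := fun k hk y hy =>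
    (hu k hk y ((abs_le.2 hy).trans hR4)).continuousAt.continuousWithinAt
  have cv : ∀ k : ℤ, |k| ≤ 2 * m → ContinuousOn (v k) (Icc (-R) R) := fun k hk y hy =>
    (hv k hk y ((abs_le.2 hy).trans hR4)).continuousAt.continuousWithinAt
  have int : ∀ f : ℝ → ℝ, ContinuousOn f (Icc (-R) R) →
      IntervalIntegrable f MeasureTheory.volume (-R) R := by
    intro f hf
    apply ContinuousOn.intervalIntegrable
    rwa [uIcc_of_le (by linarith)]
  have add2 : ∀ k : ℤ, |k| ≤ 2 * m → |k + 2| ≤ 4 * m ∧ |k - 2| ≤ 4 * m ∧ |k| ≤ 4 * m := by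
    intro k hk
    simp only [abs_le] at *
    omega
  set G : ℤ → ℝ := fun k => ∫ y in -R..R,
    (R ^ 2 - y ^ 2) ^ 2 * (2 * v k y ^ 2 + (u (k + 2) y - u k y) ^ 2 / δ ^ 2) with hG
  set W : ℤ → ℝ := fun k => ∫ y in -R..R, (R ^ 2 - y ^ 2) ^ 2 * u k y ^ 2 with hWdef
  set U : ℤ → ℝ := fun k => ∫ y in -R..R, u k y ^ 2 with hUdef
  set E := energy δ (4 * m) u with hE
  have hU0 : ∀ k, 0 ≤ U k := fun k => integral_nonneg_of_sq hR0 fun y => sq_nonneg _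
  have hW0 : ∀ k, 0 ≤ W k := fun k => integral_nonneg_of_sq hR0 fun y => by positivity
  have hG0 : ∀ k, 0 ≤ G k := fun k => integral_nonneg_of_sq hR0 fun y => by positivity
  have line : ∀ k : ℤ, |k| ≤ 2 * m →
      G k ≤ 8 * R ^ 2 * U k + (W (k + 2) - 2 * W k + W (k - 2)) / δ ^ 2 := by
    intro k hk
    obtain ⟨h1, h2, h3⟩ := add2 k hk
    exact line_energy_le hR0 hδ (fun y hy => hu k h3 y (hy.trans hR4))
      (fun y hy => hv k hk y (hy.trans hR4))
      (fun y hy => (hw k hk y ((abs_le.2 hy).trans hR4)).continuousWithinAt) (cu _ h1) (cu _ h2)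
      (fun y hy => hsub k hk y (hy.trans hR4))
  have WU : ∀ k : ℤ, |k| ≤ 4 * m → W k ≤ R ^ 4 * U k := by
    intro k hk
    have c := cu k hk
    rw [hWdef, hUdef]
    simp only
    rw [← intervalIntegral.integral_const_mul]
    refine intervalIntegral.integral_mono_on (by linarith) (int _ (by fun_prop))
      (int _ (by fun_prop)) fun y hy => ?_
    have h1 : y ^ 2 ≤ R ^ 2 := sq_le_sq' hy.1 hy.2
    have h2 : (R ^ 2 - y ^ 2) ^ 2 ≤ (R ^ 2) ^ 2 :=
      pow_le_pow_left₀ (by linarith) (by linarith [sq_nonneg y]) 2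
    calc (R ^ 2 - y ^ 2) ^ 2 * u k y ^ 2 ≤ (R ^ 2) ^ 2 * u k y ^ 2 := by gcongr
      _ = R ^ 4 * u k y ^ 2 := by ring
  have sumU : ∀ n : ℤ, n ≤ 4 * m → ∑ k ∈ Finset.Icc (-n) n, U k ≤ E := by
    intro n hn
    have h1 : ∑ k ∈ Finset.Icc (-n) n, U k ≤ ∑ k ∈ Finset.Icc (-((4 * m : ℕ) : ℤ)) (4 * m : ℕ),
        U k :=
      Finset.sum_le_sum_of_subset_of_nonneg
        (Finset.Icc_subset_Icc (by push_cast; omega) (by push_cast; omega)) fun k _ _ => hU0 k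
    refine h1.trans (Finset.sum_le_sum fun k hk => ?_)
    rw [mem_Icc_neg_iff] at hk
    push_cast at hk ⊢
    refine integral_le_integral_of_nonneg hR0 hR4 (fun y => sq_nonneg _) ?_
    have : ContinuousOn (u k) (Icc (-(4 * m * δ)) (4 * m * δ)) := fun y hy =>
      (hu k hk y (abs_le.2 hy)).continuousAt.continuousWithinAt
    fun_prop
  have hE0 : 0 ≤ E := (Finset.sum_nonneg fun k _ => hU0 k).trans (sumU 0 (by omega))
  -- The first term has the second derivative of the vertical cutoff, at most `8 R²`, times `tent ≤
  -- (2m)²`. The second has the second difference of `tent`, at most `8`, times the vertical cutoff,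
  -- at most `R⁴`.
  have upper : ∑ k ∈ Finset.Icc (-(2 * m : ℤ)) (2 * m), tent (2 * m) k * G k
      ≤ 8 * R ^ 2 * ((2 * m) ^ 2 * E) + 8 * (R ^ 4 * E) / δ ^ 2 := by
    calc ∑ k ∈ Finset.Icc (-(2 * m : ℤ)) (2 * m), tent (2 * m) k * G k
        ≤ ∑ k ∈ Finset.Icc (-(2 * m : ℤ)) (2 * m), (8 * R ^ 2 * ((2 * m) ^ 2 * U k)
          + (tent (2 * m) k * (W (k + 2) - 2 * W k + W (k - 2))) / δ ^ 2) := by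
          refine Finset.sum_le_sum fun k hk => ?_
          rw [mem_Icc_neg_iff] at hk
          have h1 := mul_le_mul_of_nonneg_left (line k hk) (tent_nonneg (2 * m) k)
          have h2 : tent (2 * m) k ≤ (2 * m) ^ 2 := by
            have := tent_le (N := 2 * m) (k := k) (by positivity)
            push_cast at this
            exact this
          have h3 : tent (2 * m) k * (8 * R ^ 2 * U k) ≤ (2 * m) ^ 2 * (8 * R ^ 2 * U k) :=
            mul_le_mul_of_nonneg_right h2 (mul_nonneg (by positivity) (hU0 k))
          have h4 : tent (2 * m) k * ((W (k + 2) - 2 * W k + W (k - 2)) / δ ^ 2)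
            = (tent (2 * m) k * (W (k + 2) - 2 * W k + W (k - 2))) / δ ^ 2 := by ring
          rw [mul_add, h4] at h1
          linarith
      _ = 8 * R ^ 2 * ((2 * m) ^ 2 * ∑ k ∈ Finset.Icc (-(2 * m : ℤ)) (2 * m), U k)
          + (∑ k ∈ Finset.Icc (-(2 * m : ℤ)) (2 * m),
              tent (2 * m) k * (W (k + 2) - 2 * W k + W (k - 2))) / δ ^ 2 := by
          rw [Finset.sum_add_distrib, Finset.mul_sum, Finset.mul_sum, Finset.sum_div]
      _ ≤ _ := by
          have h1 := sum_tent_mul_le hW0 (2 * m)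
          have h2 : ∑ k ∈ Finset.Icc (-(2 * m + 1 : ℤ)) (2 * m + 1), W k
              ≤ R ^ 4 * ∑ k ∈ Finset.Icc (-(2 * m + 1 : ℤ)) (2 * m + 1), U k := by
            rw [Finset.mul_sum]
            refine Finset.sum_le_sum fun k hk => WU k ?_
            rw [mem_Icc_neg_iff] at hk
            omega
          have h3 := mul_le_mul_of_nonneg_left (sumU (2 * m + 1) (by omega))
            (by positivity : 0 ≤ R ^ 4)
          have h4 := sumU (2 * m) (by omega)
          gcongr
          linarith
  -- On the inner box `tent ≥ m²`, and `|y| ≤ R/2` makes the vertical cutoff at least `(3R²/4)² =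
  -- 9R⁴/16`.
  have lower : (m : ℝ) ^ 2 * (9 / 16 * R ^ 4 * ∑ k ∈ Finset.Icc (-(m : ℤ)) m,
        ∫ y in -(m * δ)..(m * δ), (2 * v k y ^ 2 + (u (k + 2) y - u k y) ^ 2 / δ ^ 2))
      ≤ ∑ k ∈ Finset.Icc (-(2 * m : ℤ)) (2 * m), tent (2 * m) k * G k := by
    rw [Finset.mul_sum, Finset.mul_sum]
    refine le_trans (Finset.sum_le_sum (g := fun k => tent (2 * m) k * G k) fun k hk => ?_)
      (Finset.sum_le_sum_of_subset_of_nonneg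
        (Finset.Icc_subset_Icc (by omega) (by omega)) fun k _ _ =>
          mul_nonneg (tent_nonneg _ _) (hG0 k))
    rw [mem_Icc_neg_iff] at hk
    have hk2 : |k| ≤ 2 * m := by omega
    obtain ⟨h1, h2, h3⟩ := add2 k hk2
    have c1 := cu _ h1
    have c2 := cu _ h3
    have c3 := cv _ hk2
    have hsubI : Icc (-(m * δ)) (m * δ) ⊆ Icc (-R) R := Icc_subset_Icc (by linarith) (by linarith)
    have t1 := le_tent (m := (m : ℤ)) (by positivity) hk
    push_cast at t1
    refine mul_le_mul t1 ?_ (mul_nonneg (by positivity)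
      (integral_nonneg_of_sq hmδ.le fun y => by positivity)) (tent_nonneg _ _)
    refine le_trans ?_ (integral_le_integral_of_nonneg hmδ.le (by linarith)
      (fun y => by positivity) (by fun_prop))
    rw [← intervalIntegral.integral_const_mul]
    refine intervalIntegral.integral_mono_on (by linarith)
      (ContinuousOn.intervalIntegrable ?_) (ContinuousOn.intervalIntegrable ?_) fun y hy => ?_
    · rw [uIcc_of_le (by linarith)]
      exact ContinuousOn.mono (by fun_prop) hsubI
    · rw [uIcc_of_le (by linarith)]
      exact ContinuousOn.mono (by fun_prop) hsubI
    · have h5 : y ^ 2 ≤ (m * δ) ^ 2 := sq_le_sq' hy.1 hy.2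
      have h6 : (3 / 4 * R ^ 2) ^ 2 ≤ (R ^ 2 - y ^ 2) ^ 2 := by
        refine pow_le_pow_left₀ (by positivity) ?_ 2
        rw [hR]
        nlinarith
      have h7 : 0 ≤ 2 * v k y ^ 2 + (u (k + 2) y - u k y) ^ 2 / δ ^ 2 := by positivity
      have h8 := mul_le_mul_of_nonneg_right h6 h7
      linarith
  have fin := lower.trans upper
  set S := ∑ k ∈ Finset.Icc (-(m : ℤ)) m,
        ∫ y in -(m * δ)..(m * δ), (2 * v k y ^ 2 + (u (k + 2) y - u k y) ^ 2 / δ ^ 2)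
  have e1 : 8 * R ^ 2 * ((2 * m) ^ 2 * E) + 8 * (R ^ 4 * E) / δ ^ 2
      = (m ^ 4 * δ ^ 2) * (256 * E) := by
    rw [hR]; field_simp; ring
  have e2 : (m : ℝ) ^ 2 * (9 / 16 * R ^ 4 * S) = (m ^ 4 * δ ^ 2) * (9 * ((m * δ) ^ 2 * S)) := by
    rw [hR]; ring
  -- The constant obtained is `256/9`, which is less than `32`.
  rw [e1, e2] at fin
  have := le_of_mul_le_mul_left fin (by positivity)
  linarith

/-! ### Regularity for the first-order system -/

/-- The operator which is equal to `∂_y` on the real observables. -/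
noncomputable def twist (σ : ℤ → ℝ) (δ : ℝ) (g : ℤ → ℝ → ℝ) (k : ℤ) (y : ℝ) : ℝ :=
  σ k * (g (k + 1) y - g (k - 1) y) / δ

/-- `∂_y g = twist g` in the box of size `m`. -/
def Solves (σ : ℤ → ℝ) (δ : ℝ) (m : ℕ) (g : ℤ → ℝ → ℝ) : Prop :=
  ∀ k : ℤ, |k| ≤ m → ∀ y, |y| ≤ m * δ → HasDerivAt (g k) (twist σ δ g k y) y

/-- `σ` is an alternating sign. -/
structure Alternating (σ : ℤ → ℝ) : Prop where
  sq : ∀ k, σ k ^ 2 = 1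
  succ : ∀ k, σ (k + 1) = -σ k

theorem Alternating.pred {σ : ℤ → ℝ} (hσ : Alternating σ) (k : ℤ) : σ (k - 1) = -σ k := by
  have := hσ.succ (k - 1)
  rw [sub_add_cancel] at this
  linarith

theorem twist_twist {σ : ℤ → ℝ} (hσ : Alternating σ) {δ : ℝ} (g : ℤ → ℝ → ℝ) (k : ℤ) (y : ℝ) :
    twist σ δ (twist σ δ g) k y = -((g (k + 2) y - 2 * g k y + g (k - 2) y) / δ ^ 2) := by
  unfold twist
  rw [hσ.succ, hσ.pred, show k + 1 + 1 = k + 2 by ring, show k + 1 - 1 = k by ring,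
    show k - 1 + 1 = k by ring, show k - 1 - 1 = k - 2 by ring]
  have := hσ.sq k
  linear_combination (-(g (k + 2) y - 2 * g k y + g (k - 2) y) / δ ^ 2) * this

theorem Solves.mono {σ : ℤ → ℝ} {δ : ℝ} (hδ : 0 < δ) {m n : ℕ} {g : ℤ → ℝ → ℝ}
    (hg : Solves σ δ n g) (hmn : m ≤ n) : Solves σ δ m g := by
  intro k hk y hy
  have : (m : ℝ) ≤ n := by exact_mod_cast hmn
  exact hg k (by omega) y (hy.trans (by gcongr))

theorem Solves.hasDerivAt_twist {σ : ℤ → ℝ} {δ : ℝ} {m : ℕ} {g : ℤ → ℝ → ℝ}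
    (hg : Solves σ δ m g) {k : ℤ} (hk : |k| + 1 ≤ m) {y : ℝ} (hy : |y| ≤ m * δ) :
    HasDerivAt (twist σ δ g k) (twist σ δ (twist σ δ g) k y) y := by
  have h1 : |k + 1| ≤ m := by rw [abs_le]; have := le_abs_self k; have := neg_le_abs k; omega
  have h2 : |k - 1| ≤ m := by rw [abs_le]; have := le_abs_self k; have := neg_le_abs k; omega
  exact (((hg _ h1 y hy).sub (hg _ h2 y hy)).const_mul (σ k)).div_const δ

theorem Solves.twist {σ : ℤ → ℝ} {δ : ℝ} (hδ : 0 < δ) {m n : ℕ} {g : ℤ → ℝ → ℝ}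
    (hg : Solves σ δ n g) (hmn : m + 1 ≤ n) : Solves σ δ m (twist σ δ g) := by
  intro k hk y hy
  have : (m : ℝ) ≤ n := by exact_mod_cast (by omega : m ≤ n)
  exact hg.hasDerivAt_twist (by omega) (hy.trans (by gcongr))

/-- For a solution, `∂_y² g` cancels the horizontal second difference, so `g Δg = 0` and
Caccioppoli's inequality applies with `v = twist g`. The factor `2` in front of `v²` there gives
`16` in place of `32`. -/
theorem energy_twist_le {σ : ℤ → ℝ} (hσ : Alternating σ) {δ : ℝ} (hδ : 0 < δ) {m : ℕ}
    (hm : 1 ≤ m) {g : ℤ → ℝ → ℝ} (hg : Solves σ δ (4 * m) g) :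
    (m * δ) ^ 2 * energy δ m (twist σ δ g) ≤ 16 * energy δ (4 * m) g := by
  have cast : ∀ y : ℝ, |y| ≤ 4 * m * δ → |y| ≤ (4 * m : ℕ) * δ := fun y hy => by
    push_cast; exact hy
  have hv : ∀ k : ℤ, |k| ≤ 2 * m → ∀ y, |y| ≤ 4 * m * δ →
      HasDerivAt (twist σ δ g k) (twist σ δ (twist σ δ g) k y) y := fun k hk y hy =>
    hg.hasDerivAt_twist (by push_cast; omega) (cast y hy)
  have key := caccioppoli hδ hm (u := g) (v := twist σ δ g) (w := twist σ δ (twist σ δ g))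
    (fun k hk y hy => hg k (by push_cast; omega) y (cast y hy)) hv
    (fun k hk y hy => ?_) (fun k hk y hy => ?_)
  · have hmδ : 0 < m * δ := by have : (0 : ℝ) < m := by exact_mod_cast hm
                               positivity
    have h1 : 2 * energy δ m (twist σ δ g) ≤ ∑ k ∈ Finset.Icc (-(m : ℤ)) m,
        ∫ y in -(m * δ)..(m * δ),
          (2 * twist σ δ g k y ^ 2 + (g (k + 2) y - g k y) ^ 2 / δ ^ 2) := by
      unfold energy
      rw [Finset.mul_sum]
      refine Finset.sum_le_sum fun k hk => ?_
      rw [mem_Icc_neg_iff] at hk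
      have hle : m * δ ≤ 4 * m * δ := by linarith
      have c1 : ContinuousOn (twist σ δ g k) (Icc (-(m * δ)) (m * δ)) := fun y hy =>
        (hv k (by omega) y ((abs_le.2 hy).trans hle)).continuousAt.continuousWithinAt
      have c2 : ∀ j : ℤ, |j| ≤ 4 * m → ContinuousOn (g j) (Icc (-(m * δ)) (m * δ)) :=
        fun j hj y hy => (hg j (by push_cast; omega) y
          (cast y ((abs_le.2 hy).trans hle))).continuousAt.continuousWithinAt
      have c3 := c2 k (by omega)
      have c4 := c2 (k + 2) (by rw [abs_le] at hk ⊢; omega)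
      rw [← intervalIntegral.integral_const_mul]
      refine intervalIntegral.integral_mono_on (by linarith)
        (ContinuousOn.intervalIntegrable ?_) (ContinuousOn.intervalIntegrable ?_) fun y hy => ?_
      · rw [uIcc_of_le (by linarith)]; fun_prop
      · rw [uIcc_of_le (by linarith)]; fun_prop
      · have : 0 ≤ (g (k + 2) y - g k y) ^ 2 / δ ^ 2 := by positivity
        linarith
    have h2 := mul_le_mul_of_nonneg_left h1 (sq_nonneg (m * δ))
    linarith
  · have h1 : ContinuousAt (fun y => twist σ δ (twist σ δ g) k y) y := by
      simp only [twist_twist hσ]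
      have c2 : ∀ j : ℤ, |j| ≤ 4 * m → ContinuousAt (g j) y := fun j hj =>
        (hg j (by push_cast; omega) y (cast y hy)).continuousAt
      rw [abs_le] at hk
      have c3 := c2 k (by rw [abs_le]; omega)
      have c4 := c2 (k + 2) (by rw [abs_le]; omega)
      have c5 := c2 (k - 2) (by rw [abs_le]; omega)
      fun_prop
    exact h1
  · rw [twist_twist hσ]
    simp

/-- The discrete Sobolev inequality: `f 0² ≤ 2 f i² + 2 (f i - f 0)²`, Cauchy–Schwarz on the
telescoping sum, and summation over `i`. -/
theorem sq_le_sum_sq_add_sum_sq_sub (f : ℕ → ℝ) (L : ℕ) :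
    L * f 0 ^ 2 ≤ 2 * ∑ i ∈ Finset.range L, f i ^ 2
      + 2 * L ^ 2 * ∑ i ∈ Finset.range L, (f (i + 1) - f i) ^ 2 := by
  have h : ∀ i ∈ Finset.range L, f 0 ^ 2 ≤ 2 * f i ^ 2
      + 2 * L * ∑ i ∈ Finset.range L, (f (i + 1) - f i) ^ 2 := by
    intro i hi
    rw [Finset.mem_range] at hi
    have h1 : f i - f 0 = ∑ j ∈ Finset.range i, (f (j + 1) - f j) :=
      (Finset.sum_range_sub f i).symm
    have h2 : (f i - f 0) ^ 2 ≤ i * ∑ j ∈ Finset.range i, (f (j + 1) - f j) ^ 2 := by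
      rw [h1]
      simpa using sq_sum_le_card_mul_sum_sq (s := Finset.range i) (f := fun j => f (j + 1) - f j)
    have h3 : ∑ j ∈ Finset.range i, (f (j + 1) - f j) ^ 2
        ≤ ∑ j ∈ Finset.range L, (f (j + 1) - f j) ^ 2 :=
      Finset.sum_le_sum_of_subset_of_nonneg (Finset.range_subset_range.2 hi.le)
        fun j _ _ => sq_nonneg _
    have h4 : (i : ℝ) ≤ L := by exact_mod_cast hi.le
    have h5 : i * ∑ j ∈ Finset.range i, (f (j + 1) - f j) ^ 2
        ≤ L * ∑ j ∈ Finset.range L, (f (j + 1) - f j) ^ 2 :=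
      mul_le_mul h4 h3 (Finset.sum_nonneg fun j _ => sq_nonneg _) (by positivity)
    nlinarith [sq_nonneg (2 * f i - f 0)]
  have := Finset.sum_le_sum h
  rw [Finset.sum_const, Finset.card_range, Finset.sum_add_distrib, Finset.sum_const,
    Finset.card_range, ← Finset.mul_sum, nsmul_eq_mul, nsmul_eq_mul] at this
  linarith

/-- Values at the centre are controlled by the energy. -/
theorem sq_apply_zero_le {σ : ℤ → ℝ} (hσ : Alternating σ) {δ : ℝ} (hδ : 0 < δ) {L : ℕ}
    (hL : 1 ≤ L) {g : ℤ → ℝ → ℝ} (hg : Solves σ δ (32 * L) g) :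
    2 * (L * δ) ^ 2 * g 0 0 ^ 2 ≤ 68 * δ * energy δ (32 * L) g := by
  have hL0 : (0 : ℝ) < L := by exact_mod_cast hL
  obtain ⟨R, hR⟩ : ∃ R : ℝ, R = ((2 * L : ℕ) : ℝ) * δ := ⟨_, rfl⟩
  have hR' : R = 2 * (L * δ) := by rw [hR]; push_cast; ring
  have hR0 : 0 < R := by rw [hR']; positivity
  -- Each use of Caccioppoli's inequality costs a factor `4` in size; two of them lead from `2 L` to
  -- `32 L`.
  have hg1 : Solves σ δ (8 * L) (twist σ δ g) := hg.twist hδ (by omega)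
  have hg2 : Solves σ δ (2 * L) (twist σ δ (twist σ δ g)) := hg1.twist hδ (by omega)
  have cont : ∀ {n : ℕ} {f : ℤ → ℝ → ℝ}, Solves σ δ n f → ∀ k : ℤ, |k| ≤ n → ∀ y, |y| ≤ n * δ →
      ContinuousAt (f k) y := fun hf k hk y hy => (hf k hk y hy).continuousAt
  have e0 : energy δ (2 * L) g ≤ energy δ (32 * L) g := energy_mono hδ (by omega) (cont hg)
  have e1 : R ^ 2 * energy δ (2 * L) (twist σ δ g) ≤ 16 * energy δ (32 * L) g := by
    have h1 := energy_twist_le hσ hδ (m := 2 * L) (by omega) (hg.mono hδ (by omega))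
    rw [← hR] at h1
    have h2 : energy δ (4 * (2 * L)) g ≤ energy δ (32 * L) g :=
      energy_mono hδ (by omega) (cont hg)
    linarith
  have e2 : R ^ 4 * energy δ (2 * L) (twist σ δ (twist σ δ g)) ≤ 16 * energy δ (32 * L) g := by
    have h1 := energy_twist_le hσ hδ (m := 2 * L) (by omega) (hg1.mono hδ (by omega))
    have h2 := energy_twist_le hσ hδ (m := 8 * L) (by omega) (hg.mono hδ (by omega))
    rw [← hR] at h1
    rw [show 4 * (2 * L) = 8 * L by ring] at h1
    rw [show 4 * (8 * L) = 32 * L by ring] at h2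
    have h3 : ((8 * L : ℕ) : ℝ) * δ = 4 * R := by rw [hR']; push_cast; ring
    rw [h3] at h2
    have h4 := mul_le_mul_of_nonneg_left h1 (sq_nonneg R)
    nlinarith
  have col : ∀ {f f' : ℤ → ℝ → ℝ}, (∀ k : ℤ, |k| ≤ (2 * L : ℕ) → ∀ y, |y| ≤ (2 * L : ℕ) * δ →
      HasDerivAt (f k) (f' k y) y) → (∀ k : ℤ, |k| ≤ (2 * L : ℕ) → ∀ y, |y| ≤ (2 * L : ℕ) * δ →
      ContinuousAt (f' k) y) →
      R * ∑ k ∈ Finset.Icc (-((2 * L : ℕ) : ℤ)) (2 * L : ℕ), f k 0 ^ 2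
        ≤ 2 * energy δ (2 * L) f + R ^ 2 * energy δ (2 * L) f' := by
    intro f f' hf hf'
    unfold energy
    rw [Finset.mul_sum, Finset.mul_sum, Finset.mul_sum, ← Finset.sum_add_distrib]
    refine Finset.sum_le_sum fun k hk => ?_
    rw [mem_Icc_neg_iff] at hk
    rw [← hR]
    exact line_sobolev hR0.le (fun y hy => hf k hk y (hR ▸ hy)) fun y hy =>
      (hf' k hk y (hR ▸ abs_le.2 hy)).continuousWithinAt
  have s0 := col (hg.mono hδ (by omega)) (cont (hg1.mono hδ (by omega)))
  have s1 := col (hg1.mono hδ (by omega)) (cont hg2)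
  have row := sq_le_sum_sq_add_sum_sq_sub (fun i => g (2 * i) 0) L
  have r0 : ∑ i ∈ Finset.range L, g (2 * i) 0 ^ 2
      ≤ ∑ k ∈ Finset.Icc (-((2 * L : ℕ) : ℤ)) (2 * L : ℕ), g k 0 ^ 2 := by
    rw [← Finset.sum_image (f := fun k : ℤ => g k 0 ^ 2) (g := fun i : ℕ => (2 * i : ℤ))
      (fun i _ j _ h => by simpa using h)]
    refine Finset.sum_le_sum_of_subset_of_nonneg (fun k hk => ?_) fun k _ _ => sq_nonneg _
    simp only [Finset.mem_image, Finset.mem_range, Finset.mem_Icc] at hk ⊢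
    obtain ⟨i, hi, rfl⟩ := hk
    push_cast
    omega
  -- The horizontal increment between even columns is, up to sign, `δ` times `twist g` on the odd
  -- column between them, so `twist` controls both directions.
  have r1 : ∑ i ∈ Finset.range L, (g (2 * (i + 1 : ℕ)) 0 - g (2 * i) 0) ^ 2
      ≤ δ ^ 2 * ∑ k ∈ Finset.Icc (-((2 * L : ℕ) : ℤ)) (2 * L : ℕ), twist σ δ g k 0 ^ 2 := by
    have h1 : ∀ i ∈ Finset.range L, (g (2 * (i + 1 : ℕ)) 0 - g (2 * i) 0) ^ 2
        = δ ^ 2 * twist σ δ g (2 * i + 1) 0 ^ 2 := by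
      intro i _
      unfold twist
      rw [show (2 * i + 1 + 1 : ℤ) = 2 * (i + 1 : ℕ) by push_cast; ring,
        show (2 * i + 1 - 1 : ℤ) = 2 * i by ring, div_pow, mul_pow, hσ.sq]
      field_simp
    rw [Finset.sum_congr rfl h1, ← Finset.mul_sum]
    refine mul_le_mul_of_nonneg_left ?_ (sq_nonneg δ)
    rw [← Finset.sum_image (f := fun k : ℤ => twist σ δ g k 0 ^ 2)
      (g := fun i : ℕ => (2 * i + 1 : ℤ)) (fun i _ j _ h => by simpa using h)]
    refine Finset.sum_le_sum_of_subset_of_nonneg (fun k hk => ?_) fun k _ _ => sq_nonneg _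
    simp only [Finset.mem_image, Finset.mem_range, Finset.mem_Icc] at hk ⊢
    obtain ⟨i, hi, rfl⟩ := hk
    push_cast
    omega
  simp only [Nat.cast_zero, mul_zero] at row
  set S0 := ∑ k ∈ Finset.Icc (-((2 * L : ℕ) : ℤ)) (2 * L : ℕ), g k 0 ^ 2
  set S1 := ∑ k ∈ Finset.Icc (-((2 * L : ℕ) : ℤ)) (2 * L : ℕ), twist σ δ g k 0 ^ 2
  set E := energy δ (32 * L) g
  set E1 := energy δ (2 * L) (twist σ δ g)
  set E2 := energy δ (2 * L) (twist σ δ (twist σ δ g))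
  have t1 : L * g 0 0 ^ 2 ≤ 2 * S0 + R ^ 2 / 2 * S1 := by
    have : 2 * (L : ℝ) ^ 2 * (δ ^ 2 * S1) = R ^ 2 / 2 * S1 := by rw [hR']; ring
    rw [← this]
    have := mul_le_mul_of_nonneg_left r1 (by positivity : 0 ≤ 2 * (L : ℝ) ^ 2)
    linarith
  have t2 := mul_le_mul_of_nonneg_left t1 hR0.le
  have t3 := mul_le_mul_of_nonneg_left s1 (by positivity : 0 ≤ R ^ 2 / 2)
  have hE : 0 ≤ E := Finset.sum_nonneg fun k _ =>
    integral_nonneg_of_sq (by positivity) fun y => sq_nonneg _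
  have t4 : R * (L * g 0 0 ^ 2) ≤ 68 * E := by nlinarith
  have t5 := mul_le_mul_of_nonneg_left t4 hδ.le
  calc 2 * (L * δ) ^ 2 * g 0 0 ^ 2 = δ * (R * (L * g 0 0 ^ 2)) := by rw [hR']; ring
    _ ≤ δ * (68 * E) := t5
    _ = _ := by ring

/-! ### From a bounded primitive to pointwise bounds -/

/-- If `u` is a bounded primitive of `g²`, the energy of `g` is bounded. -/
theorem energy_le_of_primitive {σ : ℤ → ℝ} (hσ : Alternating σ) {δ : ℝ} (hδ : 0 < δ) {M : ℕ}
    (hM : 1 ≤ M) {g u : ℤ → ℝ → ℝ} {B : ℝ} (hg : Solves σ δ (8 * M) g)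
    (hu : ∀ k : ℤ, |k| ≤ 8 * M → ∀ y, |y| ≤ 8 * M * δ →
      HasDerivAt (u k) (-σ k * (g k y * g (k - 1) y)) y)
    (hstep : ∀ k : ℤ, |k| ≤ 8 * M → ∀ y, |y| ≤ 8 * M * δ →
      u (k + 2) y - u k y = δ * (g (k + 1) y ^ 2 - g k y ^ 2) / 2)
    (hu0 : ∀ k : ℤ, |k| ≤ 8 * M → ∀ y, |y| ≤ 8 * M * δ → 0 ≤ u k y ∧ u k y ≤ 2 * B) :
    δ * energy δ M g ≤ 6 * (M * δ) ^ 2 + 52224 * B ^ 2 := by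
  have hM0 : (1 : ℝ) ≤ M := by exact_mod_cast hM
  have hMδ : 0 < M * δ := by positivity
  have cast : ∀ y : ℝ, |y| ≤ 8 * M * δ → |y| ≤ (8 * M : ℕ) * δ := fun y hy => by
    push_cast; exact hy
  have hgd : ∀ k : ℤ, |k| ≤ 8 * M → ∀ y, |y| ≤ 8 * M * δ →
      HasDerivAt (g k) (twist σ δ g k y) y := fun k hk y hy =>
    hg k (by push_cast; omega) y (cast y hy)
  set v : ℤ → ℝ → ℝ := fun k y => -σ k * (g k y * g (k - 1) y) with hv
  have key := caccioppoli hδ (m := 2 * M) (by omega) (u := u) (v := v)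
    (w := fun k y => -σ k * (twist σ δ g k y * g (k - 1) y + g k y * twist σ δ g (k - 1) y))
    (fun k hk y hy => hu k (by push_cast at hk; omega) y (by push_cast at hy; linarith))
    (fun k hk y hy => ?_) (fun k hk y hy => ?_) (fun k hk y hy => ?_)
  · push_cast at key
    set Z : ℤ → ℝ := fun k => ∫ y in -(2 * M * δ)..(2 * M * δ),
      (2 * v k y ^ 2 + (u (k + 2) y - u k y) ^ 2 / δ ^ 2) with hZ
    have hZ0 : ∀ k, 0 ≤ Z k := fun k => integral_nonneg_of_sq (by positivity) fun y => by positivity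
    have hEu : energy δ (4 * (2 * M)) u ≤ 1088 * ((M * δ) * M * B ^ 2) := by
      have h1 : ∀ k ∈ Finset.Icc (-((4 * (2 * M) : ℕ) : ℤ)) (4 * (2 * M) : ℕ),
          ∫ y in -((4 * (2 * M) : ℕ) * δ)..((4 * (2 * M) : ℕ) * δ), u k y ^ 2
            ≤ 64 * (M * δ) * B ^ 2 := by
        intro k hk
        rw [mem_Icc_neg_iff] at hk
        push_cast at hk ⊢
        have cu : ContinuousOn (u k) (Icc (-(4 * (2 * M) * δ)) (4 * (2 * M) * δ)) := fun y hy =>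
          (hu k (by omega) y (by have := abs_le.2 hy; linarith)).continuousAt.continuousWithinAt
        have hle : -(4 * (2 * M) * δ) ≤ 4 * (2 * M) * δ := by linarith
        calc ∫ y in -(4 * (2 * M) * δ)..(4 * (2 * M) * δ), u k y ^ 2
            ≤ ∫ y in -(4 * (2 * M) * δ)..(4 * (2 * M) * δ), (2 * B) ^ 2 := by
              refine intervalIntegral.integral_mono_on hle
                (ContinuousOn.intervalIntegrable ?_) (by simp) fun y hy => ?_
              · rw [uIcc_of_le hle]; fun_prop
              · have h := hu0 k (by omega) y (by have := abs_le.2 hy; linarith)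
                exact pow_le_pow_left₀ h.1 h.2 2
          _ = _ := by
              rw [intervalIntegral.integral_const, smul_eq_mul]; ring
      refine (Finset.sum_le_sum h1).trans ?_
      rw [Finset.sum_const, Int.card_Icc, nsmul_eq_mul]
      have h2 : ((((4 * (2 * M) : ℕ) : ℤ) + 1 - -((4 * (2 * M) : ℕ) : ℤ)).toNat : ℝ)
          = 16 * M + 1 := by
        rw [show ((4 * (2 * M) : ℕ) : ℤ) + 1 - -((4 * (2 * M) : ℕ) : ℤ) = ((16 * M + 1 : ℕ) : ℤ) by
          push_cast; ring, Int.toNat_natCast]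
        push_cast; ring
      rw [h2]
      have h3 : 0 ≤ 64 * (M * δ) * B ^ 2 := by positivity
      nlinarith
    have hS : δ * ∑ k ∈ Finset.Icc (-(2 * M : ℤ)) (2 * M), Z k ≤ 8704 * B ^ 2 := by
      have h1 : (2 * M * δ) ^ 2 * ∑ k ∈ Finset.Icc (-(2 * M : ℤ)) (2 * M), Z k
          ≤ 34816 * ((M * δ) * M * B ^ 2) := by linarith
      have h2 : (4 * M * (M * δ)) * (δ * ∑ k ∈ Finset.Icc (-(2 * M : ℤ)) (2 * M), Z k)
          ≤ (4 * M * (M * δ)) * (8704 * B ^ 2) := by linarith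
      exact le_of_mul_le_mul_left h2 (by positivity)
    have col : ∀ k ∈ Finset.Icc (-(M : ℤ)) M,
        ∫ y in -(M * δ)..(M * δ), g k y ^ 2 ≤ 2 * (M * δ) + (2 * Z (k + 1) + 4 * Z k) := by
      intro k hk
      rw [mem_Icc_neg_iff] at hk
      rw [abs_le] at hk
      have cg : ∀ j : ℤ, |j| ≤ 8 * M → ContinuousOn (g j) (Icc (-(2 * M * δ)) (2 * M * δ)) :=
        fun j hj y hy => (hgd j hj y
          (by have := abs_le.2 hy; linarith)).continuousAt.continuousWithinAt
      have c0 := cg (k - 1) (by rw [abs_le]; omega)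
      have c1 := cg k (by rw [abs_le]; omega)
      have c2 := cg (k + 1) (by rw [abs_le]; omega)
      have cu : ∀ j : ℤ, |j| ≤ 8 * M → ContinuousOn (u j) (Icc (-(2 * M * δ)) (2 * M * δ)) :=
        fun j hj y hy => (hu j hj y
          (by have := abs_le.2 hy; linarith)).continuousAt.continuousWithinAt
      have d0 := cu k (by rw [abs_le]; omega)
      have d1 := cu (k + 1) (by rw [abs_le]; omega)
      have d2 := cu (k + 2) (by rw [abs_le]; omega)
      have d3 := cu (k + 1 + 2) (by rw [abs_le]; omega)
      have cv0 : ContinuousOn (v k) (Icc (-(2 * M * δ)) (2 * M * δ)) := by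
        simp only [hv]; fun_prop
      have cv1 : ContinuousOn (v (k + 1)) (Icc (-(2 * M * δ)) (2 * M * δ)) := by
        simp only [hv, add_sub_cancel_right]; fun_prop
      have hle : -(2 * M * δ) ≤ 2 * M * δ := by linarith
      have int : ∀ f : ℝ → ℝ, ContinuousOn f (Icc (-(2 * M * δ)) (2 * M * δ)) →
          IntervalIntegrable f MeasureTheory.volume (-(2 * M * δ)) (2 * M * δ) := by
        intro f hf
        apply ContinuousOn.intervalIntegrable
        rwa [uIcc_of_le hle]
      have ismall : ∀ f : ℝ → ℝ, ContinuousOn f (Icc (-(2 * M * δ)) (2 * M * δ)) →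
          IntervalIntegrable f MeasureTheory.volume (-(M * δ)) (M * δ) := by
        intro f hf
        apply ContinuousOn.intervalIntegrable
        rw [uIcc_of_le (by linarith)]
        exact hf.mono (Icc_subset_Icc (by linarith) (by linarith))
      have s1 : ∫ y in -(M * δ)..(M * δ), g k y ^ 2
          ≤ ∫ y in -(M * δ)..(M * δ), (1 + g k y ^ 4) := by
        refine intervalIntegral.integral_mono_on (by linarith) (ismall _ (by fun_prop))
          (ismall _ (by fun_prop)) fun y _ => ?_
        nlinarith [sq_nonneg (g k y ^ 2 - 1), sq_nonneg (g k y)]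
      rw [intervalIntegral.integral_add (by simp) (ismall _ (by fun_prop)),
        intervalIntegral.integral_const] at s1
      have s2 : ∫ y in -(M * δ)..(M * δ), g k y ^ 4
          ≤ ∫ y in -(2 * M * δ)..(2 * M * δ), g k y ^ 4 :=
        integral_le_integral_of_nonneg hMδ.le (by linarith) (fun y => by positivity) (by fun_prop)
      -- With `a = g_k²` and `b = g_{k+1}²`, the vertical derivative of `u` on column `k + 1` has
      -- square `ab`, and the horizontal quotient on column `k` has square `(a - b)²/4`. The weights
      -- are chosen so that `4ab + (a - b)² = (a + b)² ≥ a²`.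
      have s3 : ∫ y in -(2 * M * δ)..(2 * M * δ), g k y ^ 4
          ≤ ∫ y in -(2 * M * δ)..(2 * M * δ),
            (2 * (2 * v (k + 1) y ^ 2 + (u (k + 1 + 2) y - u (k + 1) y) ^ 2 / δ ^ 2)
              + 4 * (2 * v k y ^ 2 + (u (k + 2) y - u k y) ^ 2 / δ ^ 2)) := by
        refine intervalIntegral.integral_mono_on hle (int _ (by fun_prop))
          (int _ (by fun_prop)) fun y hy => ?_
        rw [hstep k (by rw [abs_le]; omega) y (by have := abs_le.2 hy; linarith)]
        have p1 : 0 ≤ (u (k + 1 + 2) y - u (k + 1) y) ^ 2 / δ ^ 2 := by positivity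
        have p2 : v (k + 1) y ^ 2 = (g (k + 1) y * g k y) ^ 2 := by
          simp only [hv, add_sub_cancel_right]
          rw [mul_pow, neg_sq, hσ.sq, one_mul]
        have p3 : (δ * (g (k + 1) y ^ 2 - g k y ^ 2) / 2) ^ 2 / δ ^ 2
            = (g (k + 1) y ^ 2 - g k y ^ 2) ^ 2 / 4 := by field_simp; ring
        rw [p2, p3]
        have p4 : 0 ≤ v k y ^ 2 := sq_nonneg _
        have p5 : 0 ≤ (g (k + 1) y ^ 2) * (g (k + 1) y ^ 2 + 2 * g k y ^ 2) := by positivity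
        nlinarith
      rw [intervalIntegral.integral_add (int _ (by fun_prop)) (int _ (by fun_prop)),
        intervalIntegral.integral_const_mul, intervalIntegral.integral_const_mul] at s3
      simp only [smul_eq_mul, mul_one] at s1
      simp only [hZ]
      linarith
    have tot : energy δ M g ≤ (2 * M + 1) * (2 * (M * δ))
        + 6 * ∑ k ∈ Finset.Icc (-(2 * M : ℤ)) (2 * M), Z k := by
      refine (Finset.sum_le_sum col).trans ?_
      rw [Finset.sum_add_distrib, Finset.sum_add_distrib, Finset.sum_const, ← Finset.mul_sum,
        ← Finset.mul_sum, Int.card_Icc, nsmul_eq_mul]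
      have h2 : (((M : ℤ) + 1 - -(M : ℤ)).toNat : ℝ) = 2 * M + 1 := by
        rw [show (M : ℤ) + 1 - -(M : ℤ) = ((2 * M + 1 : ℕ) : ℤ) by push_cast; ring,
          Int.toNat_natCast]
        push_cast; ring
      have h3 : ∑ k ∈ Finset.Icc (-(M : ℤ)) M, Z k
          ≤ ∑ k ∈ Finset.Icc (-(2 * M : ℤ)) (2 * M), Z k :=
        Finset.sum_le_sum_of_subset_of_nonneg (Finset.Icc_subset_Icc (by omega) (by omega))
          fun k _ _ => hZ0 k
      have h4 : ∑ k ∈ Finset.Icc (-(M : ℤ)) M, Z (k + 1)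
          ≤ ∑ k ∈ Finset.Icc (-(2 * M : ℤ)) (2 * M), Z k := by
        rw [sum_Icc_add_int]
        exact Finset.sum_le_sum_of_subset_of_nonneg (Finset.Icc_subset_Icc (by omega) (by omega))
          fun k _ _ => hZ0 k
      rw [h2]
      linarith
    have := mul_le_mul_of_nonneg_left tot hδ.le
    nlinarith
  · push_cast at hk hy
    refine ((hgd k (by omega) y (by linarith)).mul (hgd (k - 1) ?_ y (by linarith))).const_mul _
    rw [abs_le] at *; omega
  · push_cast at hk hy
    rw [abs_le] at hk
    have c : ∀ j : ℤ, |j| ≤ 8 * M → ContinuousAt (g j) y := fun j hj =>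
      (hgd j hj y (by linarith)).continuousAt
    have c1 := c k (by rw [abs_le]; omega)
    have c2 := c (k - 1) (by rw [abs_le]; omega)
    have c3 := c (k + 1) (by rw [abs_le]; omega)
    have c4 := c (k - 1 + 1) (by rw [abs_le]; omega)
    have c5 := c (k - 1 - 1) (by rw [abs_le]; omega)
    unfold twist
    fun_prop
  · push_cast at hk hy
    rw [abs_le] at hk
    have h1 := hstep k (by rw [abs_le]; omega) y (by linarith)
    have h2 := hstep (k - 2) (by rw [abs_le]; omega) y (by linarith)
    rw [show k - 2 + 2 = k by ring, show k - 2 + 1 = k - 1 by ring] at h2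
    refine mul_nonneg (hu0 k (by rw [abs_le]; omega) y (by linarith)).1 ?_
    have h3 : u (k + 2) y - 2 * u k y + u (k - 2) y = δ * (g (k + 1) y ^ 2 - g k y ^ 2) / 2
        - δ * (g (k - 1) y ^ 2 - g (k - 2) y ^ 2) / 2 := by linarith
    -- The Laplacian of `u` is a sum of squares: this is the subharmonicity of `u`.
    have h4 : -σ k * (twist σ δ g k y * g (k - 1) y + g k y * twist σ δ g (k - 1) y)
        + (u (k + 2) y - 2 * u k y + u (k - 2) y) / δ ^ 2
        = ((g (k + 1) y - g (k - 1) y) ^ 2 + (g k y - g (k - 2) y) ^ 2) / (2 * δ) := by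
      rw [h3]
      unfold twist
      rw [hσ.pred, show k - 1 + 1 = k by ring, show k - 1 - 1 = k - 2 by ring]
      have e : -σ k * (σ k * (g (k + 1) y - g (k - 1) y) / δ * g (k - 1) y
          + g k y * (-σ k * (g k y - g (k - 2) y) / δ))
          = σ k ^ 2 * (-(g (k + 1) y - g (k - 1) y) / δ * g (k - 1) y
          + g k y * ((g k y - g (k - 2) y) / δ)) := by ring
      rw [e, hσ.sq]
      field_simp
      ring
    rw [h4]
    positivity

/-- Bounds at the centre of a box for a solution with bounded primitive. -/
theorem bounds_at_centre {σ : ℤ → ℝ} (hσ : Alternating σ) {δ : ℝ} (hδ : 0 < δ) {L : ℕ}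
    (hL : 1 ≤ L) {g u : ℤ → ℝ → ℝ} {B : ℝ} (hg : Solves σ δ (1024 * L) g)
    (hu : ∀ k : ℤ, |k| ≤ 1024 * L → ∀ y, |y| ≤ 1024 * L * δ →
      HasDerivAt (u k) (-σ k * (g k y * g (k - 1) y)) y)
    (hstep : ∀ k : ℤ, |k| ≤ 1024 * L → ∀ y, |y| ≤ 1024 * L * δ →
      u (k + 2) y - u k y = δ * (g (k + 1) y ^ 2 - g k y ^ 2) / 2)
    (hu0 : ∀ k : ℤ, |k| ≤ 1024 * L → ∀ y, |y| ≤ 1024 * L * δ → 0 ≤ u k y ∧ u k y ≤ 2 * B) :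
    (L * δ) ^ 2 * g 0 0 ^ 2 ≤ 10 ^ 7 * ((L * δ) ^ 2 + B ^ 2) ∧
      (L * δ) ^ 4 * twist σ δ g 0 0 ^ 2 ≤ 10 ^ 7 * ((L * δ) ^ 2 + B ^ 2) := by
  have hL0 : (1 : ℝ) ≤ L := by exact_mod_cast hL
  have hLδ : 0 < L * δ := by positivity
  -- The bound on `twist g` needs the energy of `g` at size `128 L = 4 · 32 L`, which in turn needs
  -- the primitive at size `8 · 128 L = 1024 L`.
  have en : ∀ M : ℕ, 1 ≤ M → M ≤ 128 * L →
      δ * energy δ M g ≤ 6 * (M * δ) ^ 2 + 52224 * B ^ 2 := by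
    intro M h1 h2
    have h3 : (M : ℝ) ≤ 128 * L := by exact_mod_cast h2
    have h4 : 8 * M * δ ≤ 1024 * L * δ := by nlinarith
    exact energy_le_of_primitive hσ hδ h1 (hg.mono hδ (by omega))
      (fun k hk y hy => hu k (by omega) y (hy.trans h4))
      (fun k hk y hy => hstep k (by omega) y (hy.trans h4))
      (fun k hk y hy => hu0 k (by omega) y (hy.trans h4))
  constructor
  · have h1 := sq_apply_zero_le hσ hδ hL (hg.mono hδ (by omega))
    have h2 := en (32 * L) (by omega) (by omega)
    push_cast at h2
    nlinarith [sq_nonneg B]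
  · have h1 := sq_apply_zero_le hσ hδ hL (g := twist σ δ g) (hg.twist hδ (by omega))
    have h2 := energy_twist_le hσ hδ (m := 32 * L) (by omega) (hg.mono hδ (by omega))
    have h3 := en (128 * L) (by omega) (by omega)
    rw [show 4 * (32 * L) = 128 * L by ring] at h2
    push_cast at h2 h3
    have h4 := mul_le_mul_of_nonneg_left h1 (sq_nonneg (32 * (L * δ)))
    have h5 := mul_le_mul_of_nonneg_left h2 (by positivity : 0 ≤ 68 * δ)
    nlinarith [sq_nonneg B]

/-! ### Real observables of s-holomorphic functions -/

/-- `-1` on the primal columns and `1` on the dual ones. -/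
noncomputable def sgn (k : ℤ) : ℝ := if Even k then -1 else 1

theorem sgn_of_even {k : ℤ} (h : Even k) : sgn k = -1 := if_pos h

theorem sgn_of_not_even {k : ℤ} (h : ¬ Even k) : sgn k = 1 := if_neg h

theorem sgn_alternating (k₀ : ℤ) : Alternating fun k => sgn (k₀ + k) where
  sq k := by unfold sgn; split_ifs <;> norm_num
  succ k := by
    by_cases h : Even (k₀ + k) <;> simp [sgn, ← add_assoc, h]

theorem sgn_sq (k : ℤ) : sgn k ^ 2 = 1 := by
  simpa using (sgn_alternating 0).sq k

theorem sgn_succ (k : ℤ) : sgn (k + 1) = -sgn k := by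
  simpa using (sgn_alternating 0).succ k

theorem sgn_pred (k : ℤ) : sgn (k - 1) = -sgn k := by
  simpa using (sgn_alternating 0).pred k

/-- The real observable of the mid-edge `(k, y)`. -/
noncomputable def obs (F : ℤ → ℝ → ℂ) (k : ℤ) (y : ℝ) : ℝ := (F k y).re + sgn k * (F k y).im

theorem nu_div_conj : nu / conj nu = -I := by
  have h : conj nu = Complex.exp (I * (Real.pi : ℂ) / 4) := by
    unfold nu
    rw [← Complex.exp_conj]
    congr 1
    simp [map_ofNat, neg_div]
  rw [h, nu, ← Complex.exp_sub, ← Complex.exp_neg_pi_div_two_mul_I]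
  congr 1
  ring

theorem tau_div_conj (k : ℤ) : tau k / conj (tau k) = sgn k * I := by
  unfold tau sgn
  split_ifs
  · rw [nu_div_conj]; simp
  · rw [map_mul, conj_I, mul_div_mul_comm, nu_div_conj]
    simp

/-- Only `τ / conj τ` enters a projection. The lines in question are spanned by `1 ± i`, and `obs`
is twice the real coordinate along them. -/
theorem proj_tau (X : ℂ) (k : ℤ) :
    proj X (tau k) = (((X.re + sgn k * X.im) / 2 : ℝ) : ℂ) * (1 + sgn k * I) := by
  have h := sgn_sq k
  rw [proj, tau_div_conj]
  apply Complex.ext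
  · simp
  · simp
    linear_combination (-X.im / 2) * h

theorem re_add_sgn_mul_im_of_proj_eq {X Y : ℂ} {k : ℤ} (h : proj X (tau k) = proj Y (tau k)) :
    X.re + sgn k * X.im = Y.re + sgn k * Y.im := by
  rw [proj_tau, proj_tau] at h
  have := congrArg Complex.re h
  simp at this
  linarith

theorem norm_midEdge_sq (F : ℤ → ℝ → ℂ) (k : ℤ) (y : ℝ) :
    ‖midEdge F k y‖ ^ 2 = obs F k y ^ 2 / 2 := by
  rw [midEdge, proj_tau, ← Complex.normSq_eq_norm_sq, map_mul, normSq_ofReal, normSq_apply]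
  simp only [add_re, one_re, mul_re, ofReal_re, I_re, mul_zero, ofReal_im, I_im, mul_one, sub_self,
    add_zero, add_im, one_im, mul_im, zero_add]
  have := sgn_sq k
  unfold obs
  linear_combination (((F k y).re + sgn k * (F k y).im) ^ 2 / 4) * this

section

variable {δ : ℝ} {U : Set ℂ} {F : ℤ → ℝ → ℂ} {H : ℤ → ℝ → ℝ}

theorem IsSHolomorphic.obs_eq (hF : IsSHolomorphic δ U F) {k : ℤ} {y : ℝ} (h : pt δ k y ∈ U)
    (h' : pt δ (k - 1) y ∈ U) : obs F (k - 1) y = (F k y).re - sgn k * (F k y).im := by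
  have := re_add_sgn_mul_im_of_proj_eq (hF.projection (k - 1) y h' (by rwa [sub_add_cancel]))
  rw [sub_add_cancel] at this
  unfold obs
  rw [this, sgn_pred]
  ring

theorem IsSHolomorphic.hasDerivAt (hδ : 0 < δ) (hF : IsSHolomorphic δ U F) {k : ℤ} {y : ℝ}
    (h : pt δ k y ∈ U) (h₁ : pt δ (k + 1) y ∈ U) (h₂ : pt δ (k - 1) y ∈ U) :
    HasDerivAt (F k) (I * (F (k + 1) y - F (k - 1) y) / δ) y := by
  have hd := (hF.differentiable k y h).hasDerivAt
  have h0 := hF.holomorphic k y h h₁ h₂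
  have hδ' : (δ : ℂ) ≠ 0 := by exact_mod_cast hδ.ne'
  unfold dbar at h0
  refine hd.congr_deriv ?_
  have h3 : (F (k + 1) y - F (k - 1) y) / δ = deriv (F k) y / I := by
    linear_combination 2 * h0
  rw [mul_div_assoc, h3]
  field_simp

/-- Multiplication by `i` exchanges real and imaginary parts up to sign; this matches the
alternation of `sgn`, so `∂_y F = i (F⁺ - F⁻)/δ` closes into an equation for `obs F` alone. -/
theorem IsSHolomorphic.hasDerivAt_obs (hδ : 0 < δ) (hF : IsSHolomorphic δ U F) {k : ℤ} {y : ℝ}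
    (h : pt δ k y ∈ U) (h₁ : pt δ (k + 1) y ∈ U) (h₂ : pt δ (k - 1) y ∈ U) :
    HasDerivAt (obs F k) (twist sgn δ (obs F) k y) y := by
  have hd := hF.hasDerivAt hδ h h₁ h₂
  have h3 : HasDerivAt (fun y => (F k y).re) (I * (F (k + 1) y - F (k - 1) y) / δ).re y :=
    Complex.reCLM.hasFDerivAt.comp_hasDerivAt y hd
  have h4 : HasDerivAt (fun y => (F k y).im) (I * (F (k + 1) y - F (k - 1) y) / δ).im y :=
    Complex.imCLM.hasFDerivAt.comp_hasDerivAt y hd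
  refine (h3.add (h4.const_mul (sgn k))).congr_deriv ?_
  rw [Complex.div_ofReal_re, Complex.div_ofReal_im]
  simp only [mul_re, I_re, zero_mul, I_im, sub_im, one_mul, zero_sub, mul_im, sub_re, zero_add,
    twist, obs, sgn_succ, sgn_pred]
  have := sgn_sq k
  linear_combination (((F (k + 1) y).im - (F (k - 1) y).im) / δ) * this

theorem IsPrimitive.sub_succ (hH : IsPrimitive δ U F H) {k : ℤ} {y : ℝ} (h : pt δ k y ∈ U)
    (h₁ : pt δ (k + 1) y ∈ U) : H (k + 1) y - H k y = sgn k * δ * obs F k y ^ 2 / 2 := by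
  by_cases hk : Even k
  · have := hH.edge_primal_dual k y hk h h₁
    rw [norm_midEdge_sq] at this
    rw [sgn_of_even hk]
    linarith
  · have := hH.edge_dual_primal k y hk h h₁
    rw [norm_midEdge_sq] at this
    rw [sgn_of_not_even hk]
    linarith

/-- `Im (i F²) = (Re F)² - (Im F)²` factors into the observables of the two mid-edges at the vertex.
-/
theorem IsPrimitive.hasDerivAt (hH : IsPrimitive δ U F H) (hF : IsSHolomorphic δ U F) {k : ℤ}
    {y y₁ y₂ : ℝ} (hy : y ∈ Ioo y₁ y₂) (h : ∀ t ∈ Icc y₁ y₂, pt δ k t ∈ U)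
    (h' : pt δ (k - 1) y ∈ U) :
    HasDerivAt (H k) (obs F k y * obs F (k - 1) y) y := by
  have hc : ContinuousOn (fun t => I * F k t ^ 2) (Icc y₁ y₂) := by
    have : ContinuousOn (F k) (Icc y₁ y₂) := fun t ht =>
      (hF.differentiable k t (h t ht)).continuousAt.continuousWithinAt
    fun_prop
  have hd : HasDerivAt (fun t => ∫ s in y₁..t, I * F k s ^ 2) (I * F k y ^ 2) y := by
    refine intervalIntegral.integral_hasDerivAt_right ?_ ?_ ?_
    · refine ContinuousOn.intervalIntegrable (hc.mono ?_)
      rw [uIcc_of_le hy.1.le]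
      exact Icc_subset_Icc_right hy.2.le
    · exact (hc.mono Ioo_subset_Icc_self).stronglyMeasurableAtFilter isOpen_Ioo y hy
    · exact hc.continuousAt (Icc_mem_nhds hy.1 hy.2)
  have h3 : HasDerivAt (fun t => (∫ s in y₁..t, I * F k s ^ 2).im) (I * F k y ^ 2).im y :=
    Complex.imCLM.hasFDerivAt.comp_hasDerivAt y hd
  have h4 : HasDerivAt (H k) (I * F k y ^ 2).im y := by
    refine (h3.const_add (H k y₁)).congr_of_eventuallyEq ?_
    filter_upwards [Ioo_mem_nhds hy.1 hy.2] with t ht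
    have := hH.vertical k y₁ t ht.1.le fun s hs => h s ⟨hs.1, hs.2.trans ht.2.le⟩
    linarith
  refine h4.congr_deriv ?_
  rw [hF.obs_eq (h y (Ioo_subset_Icc_self hy)) h', obs]
  have := sgn_sq k
  simp [sq] at this ⊢
  linear_combination (F k y).im * (F k y).im * this

/-- Bounds at a vertex for the real observable, in terms of a bound for the primitive in a box. -/
theorem obs_bounds (hδ : 0 < δ) (hF : IsSHolomorphic δ U F) (hH : IsPrimitive δ U F H)
    {k₀ : ℤ} {y₀ : ℝ} {L : ℕ} (hL : 1 ≤ L) {B : ℝ}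
    (hbox : ∀ k y, |k - k₀| ≤ 1024 * L + 2 → |y - y₀| ≤ 1025 * L * δ →
      pt δ k y ∈ U ∧ |H k y| ≤ B) :
    (L * δ) ^ 2 * obs F k₀ y₀ ^ 2 ≤ 10 ^ 7 * ((L * δ) ^ 2 + B ^ 2) ∧
      (L * δ) ^ 4 * twist sgn δ (obs F) k₀ y₀ ^ 2 ≤ 10 ^ 7 * ((L * δ) ^ 2 + B ^ 2) := by
  have hLδ : 0 < L * δ := by have : (1 : ℝ) ≤ L := by exact_mod_cast hL
                             positivity
  have mem : ∀ (k j : ℤ) (y : ℝ), |k| ≤ 1024 * L → |j| ≤ 2 → |y| ≤ 1025 * L * δ →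
      pt δ (k₀ + k + j) (y₀ + y) ∈ U := by
    intro k j y hk hj hy
    refine (hbox _ _ ?_ ?_).1
    · rw [abs_le] at *; omega
    · rwa [add_sub_cancel_left]
  have mem0 : ∀ (k : ℤ) (y : ℝ), |k| ≤ 1024 * L → |y| ≤ 1025 * L * δ →
      pt δ (k₀ + k) (y₀ + y) ∈ U := fun k y hk hy => by
    simpa using mem k 0 y hk (by simp) hy
  have wide : ∀ y : ℝ, |y| ≤ 1024 * L * δ → |y| ≤ 1025 * L * δ := fun y hy => by linarith
  have tw : ∀ k y, twist (fun k => sgn (k₀ + k)) δ (fun k y => obs F (k₀ + k) (y₀ + y)) k y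
      = twist sgn δ (obs F) (k₀ + k) (y₀ + y) := by
    intro k y
    simp only [twist, add_assoc, add_sub_assoc]
  -- The box is recentred at `(k₀, y₀)`. The sign `sgn` makes `B - sgn * H` subharmonic on both
  -- sublattices. The two spare columns and the extra height serve the neighbours and the two-sided
  -- derivatives.
  have key := bounds_at_centre (sgn_alternating k₀) hδ hL
    (g := fun k y => obs F (k₀ + k) (y₀ + y)) (u := fun k y => B - sgn (k₀ + k) *
      H (k₀ + k) (y₀ + y)) (B := B) ?_ ?_ ?_ ?_
  · rw [tw] at key
    simpa using key
  · intro k hk y hy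
    push_cast at hk hy
    rw [tw]
    have hy := wide y hy
    have h1 := hF.hasDerivAt_obs hδ (mem0 k y hk hy) (mem k 1 y hk (by norm_num) hy)
      (by simpa [sub_eq_add_neg] using mem k (-1) y hk (by norm_num) hy)
    exact h1.comp_const_add y₀ y
  · intro k hk y hy
    have h1 := hH.hasDerivAt hF (k := k₀ + k) (y := y₀ + y) (y₁ := y₀ - 1025 * L * δ)
      (y₂ := y₀ + 1025 * L * δ) (by rw [abs_le] at hy; constructor <;> linarith)
      (fun t ht => by
        have := mem0 k (t - y₀) hk (abs_le.2 ⟨by linarith [ht.1], by linarith [ht.2]⟩)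
        rwa [add_sub_cancel] at this)
      (by simpa [sub_eq_add_neg] using mem k (-1) y hk (by norm_num) (wide y hy))
    have h2 := ((h1.comp_const_add y₀ y).const_mul (sgn (k₀ + k))).const_sub B
    refine h2.congr_deriv ?_
    rw [add_sub_assoc]
    ring
  · intro k hk y hy
    have hy := wide y hy
    have m0 := mem0 k y hk hy
    have m1 := mem k 1 y hk (by norm_num) hy
    have m2 := mem k 2 y hk (by norm_num) hy
    have h1 := hH.sub_succ m0 m1
    have h2 := hH.sub_succ m1 (by rwa [add_assoc, one_add_one_eq_two])
    rw [sgn_succ] at h2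
    rw [add_assoc (k₀ + k), one_add_one_eq_two] at h2
    have h3 : sgn (k₀ + k + 2) = sgn (k₀ + k) := by
      rw [← one_add_one_eq_two, ← add_assoc, sgn_succ, sgn_succ, neg_neg]
    simp only [← add_assoc, h3]
    have := sgn_sq (k₀ + k)
    linear_combination (-sgn (k₀ + k)) * h1 - sgn (k₀ + k) * h2
      + (δ * (obs F (k₀ + k + 1) (y₀ + y) ^ 2 - obs F (k₀ + k) (y₀ + y) ^ 2) / 2) * this
  · intro k hk y hy
    have hy := wide y hy
    have h1 := abs_le.1 (hbox (k₀ + k) (y₀ + y) (by rw [add_sub_cancel_left]; omega)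
      (by rwa [add_sub_cancel_left])).2
    unfold sgn
    split_ifs <;> constructor <;> linarith

end

/-! ### Bounds uniform in the mesh -/

theorem isCompact_rect (c : ℂ) (a b : ℝ) : IsCompact (rect c a b) := by
  have : rect c a b = Icc (c.re - a) (c.re + a) ×ℂ Icc (c.im - b) (c.im + b) := by
    ext z
    simp only [rect, mem_ofPred_eq, abs_le, mem_reProdIm, mem_Icc]
    constructor <;> rintro ⟨⟨_, _⟩, _, _⟩ <;> refine ⟨⟨?_, ?_⟩, ?_, ?_⟩ <;> linarith
  rw [this]
  exact isCompact_Icc.reProdIm isCompact_Icc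

theorem pt_mem_rect {δ : ℝ} {k : ℤ} {y : ℝ} {c : ℂ} {a b : ℝ} :
    pt δ k y ∈ rect c a b ↔ |k * δ / 2 - c.re| ≤ a ∧ |y - c.im| ≤ b := Iff.rfl

/-- Interior bounds for the observable, uniform in the mesh. -/
theorem exists_obs_bound {a b : ℝ} (ha : 0 < a) (hb : 0 < b) (B : ℝ) :
    ∃ C : ℝ, 0 ≤ C ∧ ∀ (δ : ℝ) (U : Set ℂ) (F : ℤ → ℝ → ℂ) (H : ℤ → ℝ → ℝ) (c : ℂ),
      0 < δ → δ ≤ min a b / 400 → IsSHolomorphic δ U F → IsPrimitive δ U F H →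
      rect c (9 * a) (9 * b) ⊆ U →
      (∀ k y, pt δ k y ∈ rect c (9 * a) (9 * b) → |H k y| ≤ B) →
      ∀ k y, pt δ k y ∈ rect c (2 * a) (2 * b) →
        |obs F k y| ≤ C ∧ |twist sgn δ (obs F) k y| ≤ C := by
  obtain ⟨q, hq⟩ : ∃ q, q = min a b / 400 := ⟨_, rfl⟩
  have hq0 : 0 < q := by rw [hq]; have := lt_min ha hb; positivity
  have hqa : 400 * q ≤ a := by have := min_le_left a b; linarith
  have hqb : 400 * q ≤ b := by have := min_le_right a b; linarith
  set D : ℝ := 10 ^ 7 * (1 + B ^ 2 / q ^ 2) with hD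
  have hD0 : 0 ≤ D := by positivity
  refine ⟨√(D + D / q ^ 2), Real.sqrt_nonneg _, ?_⟩
  intro δ U F H c hδ hδq hF hH hU hB k₀ y₀ hp
  rw [← hq] at hδq
  rw [pt_mem_rect] at hp
  -- This choice gives `q ≤ L δ ≤ 2q`. Boxes around points of `2Q` then have height at most `1025 ·
  -- 2q < 6b` and smaller width, so they fit in `9Q`.
  obtain ⟨L, hL⟩ : ∃ L : ℕ, L = ⌊2 * q / δ⌋₊ := ⟨_, rfl⟩
  have hx : 2 ≤ 2 * q / δ := by rw [le_div_iff₀ hδ]; linarith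
  have hL1 : 1 ≤ L := by
    rw [hL]; exact Nat.le_floor (by push_cast; linarith)
  have hLu : L * δ ≤ 2 * q := by
    have := Nat.floor_le (by linarith : 0 ≤ 2 * q / δ)
    rw [← hL] at this
    rwa [le_div_iff₀ hδ] at this
  have hLl : q ≤ L * δ := by
    have := Nat.lt_floor_add_one (2 * q / δ)
    rw [← hL, div_lt_iff₀ hδ] at this
    linarith
  have key := obs_bounds hδ hF hH (k₀ := k₀) (y₀ := y₀) hL1 (B := B) fun k y hk hy => by
    have hmem : pt δ k y ∈ rect c (9 * a) (9 * b) := by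
      rw [pt_mem_rect]
      have hk' : |(k : ℝ) - k₀| ≤ 1024 * L + 2 := by exact_mod_cast hk
      rw [abs_le] at hk' hy
      rw [abs_le, abs_le] at hp
      obtain ⟨⟨p1, p2⟩, p3, p4⟩ := hp
      constructor
      · have h1 := mul_le_mul_of_nonneg_right hk'.1 hδ.le
        have h2 := mul_le_mul_of_nonneg_right hk'.2 hδ.le
        rw [abs_le]
        constructor <;> nlinarith
      · rw [abs_le]; constructor <;> nlinarith
    exact ⟨hU hmem, hB k y hmem⟩
  set r := L * δ
  have hr0 : 0 < r := hq0.trans_le hLl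
  have hB2 : B ^ 2 ≤ B ^ 2 / q ^ 2 * r ^ 2 := by
    rw [div_mul_eq_mul_div, le_div_iff₀ (by positivity)]
    gcongr
  have hbd : 10 ^ 7 * (r ^ 2 + B ^ 2) ≤ r ^ 2 * D := by rw [hD]; linarith
  constructor
  · refine Real.abs_le_sqrt ?_
    have h1 : obs F k₀ y₀ ^ 2 ≤ D := le_of_mul_le_mul_left (key.1.trans hbd) (by positivity)
    have : 0 ≤ D / q ^ 2 := by positivity
    linarith
  · refine Real.abs_le_sqrt ?_
    have h1 : r ^ 2 * (r ^ 2 * twist sgn δ (obs F) k₀ y₀ ^ 2) ≤ r ^ 2 * D := by linarith [key.2]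
    have h2 := le_of_mul_le_mul_left h1 (by positivity)
    have h3 : q ^ 2 * twist sgn δ (obs F) k₀ y₀ ^ 2 ≤ D := le_trans (by gcongr) h2
    have h4 : twist sgn δ (obs F) k₀ y₀ ^ 2 ≤ D / q ^ 2 := by
      rw [le_div_iff₀ (by positivity)]; linarith
    linarith

/-! ### Boundedness and Lipschitz estimate for `F` -/

section

variable {δ : ℝ} {U : Set ℂ} {F : ℤ → ℝ → ℂ}

theorem IsSHolomorphic.norm_le (hF : IsSHolomorphic δ U F) {k : ℤ} {y C : ℝ}
    (h : pt δ k y ∈ U) (h' : pt δ (k - 1) y ∈ U) (hC : |obs F k y| ≤ C)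
    (hC' : |obs F (k - 1) y| ≤ C) : ‖F k y‖ ≤ 2 * C := by
  rw [hF.obs_eq h h', abs_le] at hC'
  rw [obs, abs_le] at hC
  refine (Complex.norm_le_abs_re_add_abs_im _).trans ?_
  have h1 : |(F k y).re| ≤ C := by rw [abs_le]; constructor <;> linarith
  have h2 : |sgn k * (F k y).im| ≤ C := by rw [abs_le]; constructor <;> linarith
  have h3 : |sgn k| = 1 := by unfold sgn; split_ifs <;> norm_num
  rw [abs_mul, h3, one_mul] at h2
  linarith

/-- The increment of `F` across a mid-edge has zero projection there, so its real and imaginary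
parts agree up to sign; the real part is half the increment of `obs F` from `k - 1` to `k + 1`. -/
theorem IsSHolomorphic.norm_succ_sub_le (hδ : 0 < δ) (hF : IsSHolomorphic δ U F) {k : ℤ}
    {y C : ℝ} (h : pt δ k y ∈ U) (h₁ : pt δ (k + 1) y ∈ U) (h₂ : pt δ (k - 1) y ∈ U)
    (hC : |twist sgn δ (obs F) k y| ≤ C) : ‖F (k + 1) y - F k y‖ ≤ δ * C := by
  have e1 := re_add_sgn_mul_im_of_proj_eq (hF.projection k y h h₁)
  have e2 := hF.obs_eq h h₂
  have hs := sgn_sq k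
  have h3 : obs F (k + 1) y - obs F (k - 1) y = 2 * ((F (k + 1) y).re - (F k y).re) := by
    rw [e2, obs, sgn_succ]; linarith
  have h4 : δ * twist sgn δ (obs F) k y = 2 * sgn k * ((F (k + 1) y).re - (F k y).re) := by
    unfold twist
    rw [h3]
    field_simp
  have h5 : (F (k + 1) y).im - (F k y).im = -(sgn k * ((F (k + 1) y).re - (F k y).re)) := by
    linear_combination (-sgn k) * e1 - ((F (k + 1) y).im - (F k y).im) * hs
  have h6 : |sgn k| = 1 := by unfold sgn; split_ifs <;> norm_num
  refine (Complex.norm_le_abs_re_add_abs_im _).trans ?_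
  rw [sub_re, sub_im, h5, abs_neg, abs_mul, h6, one_mul]
  have h7 := congrArg abs h4
  rw [abs_mul, abs_mul, abs_mul, h6, abs_of_pos hδ, abs_two, mul_one] at h7
  have h8 := mul_le_mul_of_nonneg_left hC hδ.le
  linarith

/-- An s-holomorphic function with bounded derivative is Lipschitz on a rectangle. -/
theorem IsSHolomorphic.norm_sub_le (hδ : 0 < δ) (hF : IsSHolomorphic δ U F) {c : ℂ} {a b C : ℝ}
    (hδa : δ ≤ a) (hC : 0 ≤ C) (hb : 0 ≤ b) (hU : rect c (2 * a) (2 * b) ⊆ U)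
    (hbd : ∀ k y, pt δ k y ∈ rect c (2 * a) (2 * b) → |twist sgn δ (obs F) k y| ≤ C)
    {k k' : ℤ} {y y' : ℝ} (h : pt δ k y ∈ rect c a b) (h' : pt δ k' y' ∈ rect c a b) :
    ‖F k y - F k' y'‖ ≤ 4 * C * dist (pt δ k y) (pt δ k' y') := by
  have big : ∀ (k j : ℤ) (y : ℝ), |j| ≤ 2 → pt δ k y ∈ rect c a b →
      pt δ (k + j) y ∈ rect c (2 * a) (2 * b) := by
    intro k j y hj hp
    have hj' : |(j : ℝ)| ≤ 2 := by exact_mod_cast hj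
    rw [pt_mem_rect] at hp ⊢
    push_cast
    rw [abs_le] at *
    obtain ⟨⟨p1, p2⟩, p3⟩ := hp
    refine ⟨?_, by linarith⟩
    constructor <;> nlinarith
  have big0 : ∀ (k : ℤ) (y : ℝ), pt δ k y ∈ rect c a b → pt δ k y ∈ rect c (2 * a) (2 * b) :=
    fun k y hp => by simpa using big k 0 y (by simp) hp
  have bigm : ∀ (k : ℤ) (y : ℝ), pt δ k y ∈ rect c a b →
      pt δ (k - 1) y ∈ rect c (2 * a) (2 * b) :=
    fun k y hp => by simpa [sub_eq_add_neg] using big k (-1) y (by norm_num) hp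
  have step : ∀ (k : ℤ) (y : ℝ), pt δ k y ∈ rect c a b → ‖F (k + 1) y - F k y‖ ≤ δ * C :=
    fun k y hp => hF.norm_succ_sub_le hδ (hU (big0 k y hp)) (hU (big k 1 y (by norm_num) hp))
      (hU (bigm k y hp)) (hbd k y (big0 k y hp))
  have hor : ∀ (y : ℝ) (n : ℕ) (k : ℤ), pt δ k y ∈ rect c a b → pt δ (k + n) y ∈ rect c a b →
      ‖F (k + n) y - F k y‖ ≤ n * (δ * C) := by
    intro y n
    induction n with
    | zero => intro k _ _; simp
    | succ n ih =>
      intro k hp hp'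
      have hm : pt δ (k + n) y ∈ rect c a b := by
        rw [pt_mem_rect] at *
        push_cast at *
        rw [abs_le] at *
        have : 0 ≤ n * δ := by positivity
        refine ⟨?_, hp.2⟩
        constructor <;> nlinarith [hp.1.1, hp.1.2, hp'.1.1, hp'.1.2]
      have h1 := ih k hp hm
      have h2 := step (k + n) y hm
      have h3 := norm_sub_le_norm_sub_add_norm_sub (F (k + n + 1) y) (F (k + n) y) (F k y)
      push_cast
      rw [← add_assoc]
      linarith
  have hor' : ∀ (y : ℝ) (j k : ℤ), pt δ j y ∈ rect c a b → pt δ k y ∈ rect c a b → j ≤ k →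
      ‖F k y - F j y‖ ≤ 2 * C * |k * δ / 2 - j * δ / 2| := by
    intro y j k hj hk hjk
    obtain ⟨n, rfl⟩ := Int.le.dest hjk
    refine (hor y n j hj hk).trans (le_of_eq ?_)
    push_cast
    rw [show ((j : ℝ) + n) * δ / 2 - j * δ / 2 = n * δ / 2 by ring, abs_of_nonneg (by positivity)]
    ring
  have hor'' : ∀ (y : ℝ) (j k : ℤ), pt δ j y ∈ rect c a b → pt δ k y ∈ rect c a b →
      ‖F k y - F j y‖ ≤ 2 * C * |k * δ / 2 - j * δ / 2| := by
    intro y j k hj hk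
    rcases le_total j k with hjk | hjk
    · exact hor' y j k hj hk hjk
    · rw [norm_sub_rev, abs_sub_comm]
      exact hor' y k j hk hj hjk
  -- The two points are joined through this corner. Horizontal steps of length `δ/2` cost `δ C` and
  -- `|∂_y F| ≤ 2C`, so each leg has slope `2C`.
  have hcorner : pt δ k' y ∈ rect c a b := ⟨h'.1, h.2⟩
  have hver : ‖F k' y - F k' y'‖ ≤ 2 * C * ‖y - y'‖ := by
    have hmem : ∀ t ∈ Icc (c.im - b) (c.im + b), pt δ k' t ∈ rect c a b := fun t ht =>
      ⟨h'.1, abs_le.2 ⟨by simp only [pt]; linarith [ht.1], by simp only [pt]; linarith [ht.2]⟩⟩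
    have hy : ∀ {t : ℝ}, |t - c.im| ≤ b → t ∈ Icc (c.im - b) (c.im + b) := fun ht => by
      rw [abs_le] at ht; constructor <;> linarith
    refine Convex.norm_image_sub_le_of_norm_hasDerivWithin_le (s := Icc (c.im - b) (c.im + b))
      (f' := fun t => I * (F (k' + 1) t - F (k' - 1) t) / δ) (fun t ht => ?_) (fun t ht => ?_)
      (convex_Icc _ _) (hy h'.2) (hy h.2)
    · have hp := hmem t ht
      exact (hF.hasDerivAt hδ (hU (big0 _ _ hp)) (hU (big _ 1 _ (by norm_num) hp))
        (hU (bigm _ _ hp))).hasDerivWithinAt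
    · have hp := hmem t ht
      have h1 := step k' t hp
      have h2 : ‖F k' t - F (k' - 1) t‖ ≤ δ * C := by
        have e1 := hF.norm_succ_sub_le (k := k' - 1) (y := t) (C := C) hδ (hU (bigm _ _ hp))
          (by rw [sub_add_cancel]; exact hU (big0 _ _ hp))
          (hU (by simpa [sub_eq_add_neg, add_assoc] using big k' (-2) t (by norm_num) hp))
          (hbd _ _ (bigm _ _ hp))
        rwa [sub_add_cancel] at e1
      have h3 := norm_sub_le_norm_sub_add_norm_sub (F (k' + 1) t) (F k' t) (F (k' - 1) t)
      rw [norm_div, norm_mul, norm_I, one_mul, Complex.norm_real, Real.norm_of_nonneg hδ.le,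
        div_le_iff₀ hδ]
      linarith
  have hh := hor'' y k' k hcorner h
  have h1 := norm_sub_le_norm_sub_add_norm_sub (F k y) (F k' y) (F k' y')
  have h2 : |k * δ / 2 - k' * δ / 2| ≤ dist (pt δ k y) (pt δ k' y') := by
    rw [dist_eq]
    simpa [pt] using Complex.abs_re_le_norm (pt δ k y - pt δ k' y')
  have h3 : ‖y - y'‖ ≤ dist (pt δ k y) (pt δ k' y') := by
    rw [dist_eq]
    simpa [pt] using Complex.abs_im_le_norm (pt δ k y - pt δ k' y')
  have h4 := mul_le_mul_of_nonneg_left h2 (by linarith : 0 ≤ 2 * C)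
  have h5 := mul_le_mul_of_nonneg_left h3 (by linarith : 0 ≤ 2 * C)
  linarith

end

/-! ### Compactness and conclusion -/

/-- The Arzelà–Ascoli theorem for Lipschitz functions on varying subsets of a compact set. -/
theorem exists_subseq_tendsto_uniformly {K : Set ℂ} (hK : IsCompact K) {C : NNReal} {M : ℝ}
    {S : ℕ → Set ℂ} (hS : ∀ n, S n ⊆ K) {f : ℕ → ℂ → ℂ}
    (hf : ∀ᶠ n in atTop, LipschitzOnWith C (f n) (S n) ∧ ∀ p ∈ S n, ‖f n p‖ ≤ M) :
    ∃ (φ : ℕ → ℕ) (g : ℂ → ℂ), StrictMono φ ∧ ContinuousOn g K ∧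
      ∀ ε > 0, ∀ᶠ n in atTop, ∀ p ∈ S (φ n), ‖f (φ n) p - g p‖ < ε := by
  classical
  have : CompactSpace K := isCompact_iff_compactSpace.1 hK
  obtain ⟨d, hd⟩ := Metric.isBounded_iff.1 hK.isBounded
  set C' : NNReal := lipschitzExtensionConstant ℂ * C
  set A : Set (BoundedContinuousFunction K ℂ) :=
    {g | LipschitzWith C' g ∧ ∀ x, g x ∈ Metric.closedBall (0 : ℂ) (|M| + C' * |d|)} with hA
  have hAc : IsCompact (closure A) := by
    refine BoundedContinuousFunction.arzela_ascoli _ (isCompact_closedBall _ _) A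
      (fun g x hg => hg.2 x) ?_
    exact (LipschitzWith.uniformEquicontinuous _ C' fun g => g.2.1).equicontinuous
  -- Each function is extended from `S n` to `K` with a Lipschitz constant independent of `n`. The
  -- zero function is used where the bounds fail or `S n` is empty.
  have hex : ∀ n, ∃ g ∈ A, (LipschitzOnWith C (f n) (S n) ∧ ∀ p ∈ S n, ‖f n p‖ ≤ M) →
      ∀ p (hp : p ∈ S n), g ⟨p, hS n hp⟩ = f n p := by
    intro n
    by_cases hn : (LipschitzOnWith C (f n) (S n) ∧ ∀ p ∈ S n, ‖f n p‖ ≤ M) ∧ (S n).Nonempty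
    · obtain ⟨⟨hl, hb⟩, q, hq⟩ := hn
      obtain ⟨g, hg, hgf⟩ := hl.extend_finite_dimension
      have hgK : LipschitzWith C' fun x : K => g x := by
        simpa [Function.comp_def] using hg.comp (LipschitzWith.subtype_val K)
      refine ⟨BoundedContinuousFunction.mkOfCompact ⟨_, hgK.continuous⟩, ⟨hgK, fun x => ?_⟩,
        fun _ p hp => (hgf hp).symm⟩
      have h1 := hg.dist_le_mul x q
      have h2 := hd x.2 (hS n hq)
      have h3 := hb q hq
      rw [hgf hq] at h3
      rw [mem_closedBall_zero_iff]
      change ‖g x‖ ≤ _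
      have h4 : ‖g x‖ ≤ dist (g x) (g q) + ‖g q‖ := by
        rw [dist_eq_norm]; simpa using norm_add_le (g x - g q) (g q)
      have h5 : C' * dist (x : ℂ) q ≤ C' * |d| :=
        mul_le_mul_of_nonneg_left (h2.trans (le_abs_self d)) C'.2
      have h6 := le_abs_self M
      linarith
    · refine ⟨0, ⟨LipschitzWith.const' (0 : ℂ), fun x => ?_⟩, fun h p hp => ?_⟩
      · simp; positivity
      · exact absurd ⟨h, p, hp⟩ hn
  choose G hGA hG using hex
  obtain ⟨g, -, φ, hφ, hlim⟩ := hAc.tendsto_subseq fun n => subset_closure (hGA n)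
  refine ⟨φ, fun z => if h : z ∈ K then g ⟨z, h⟩ else 0, hφ, ?_, fun ε hε => ?_⟩
  · rw [continuousOn_iff_continuous_domRestrict]
    convert g.continuous using 1
    ext x
    simp
  · filter_upwards [Metric.tendsto_nhds.1 hlim ε hε, hφ.tendsto_atTop.eventually hf]
      with n hn hfn p hp
    rw [dif_pos (hS _ hp), ← hG _ hfn p hp, ← dist_eq_norm]
    exact (BoundedContinuousFunction.dist_coe_le_dist _).trans_lt hn

end SemiDiscrete

theorem theorem4p3 (Ω : Set ℂ) (hΩ : SemiDiscrete.IsPlanarDomain Ω)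
    (δ₀ : ℝ) (hδ₀ : 0 < δ₀) (D : ℝ → Set ℂ) (hD : SemiDiscrete.IsSemiDiscretization Ω δ₀ D)
    (c : ℂ) (a b : ℝ) (ha : 0 < a) (hb : 0 < b)
    (hQ : SemiDiscrete.rect c (9 * a) (9 * b) ⊆ Ω)
    (F : ℝ → ℤ → ℝ → ℂ) (H : ℝ → ℤ → ℝ → ℝ)
    (hF : ∀ δ, 0 < δ → δ < δ₀ → SemiDiscrete.IsSHolomorphic δ (D δ) (F δ))
    (hH : ∀ δ, 0 < δ → δ < δ₀ → SemiDiscrete.IsPrimitive δ (D δ) (F δ) (H δ))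
    (hbdd : ∃ M : ℝ, ∀ δ, 0 < δ → δ < δ₀ → ∀ (k : ℤ) (y : ℝ),
      SemiDiscrete.pt δ k y ∈ D δ → SemiDiscrete.pt δ k y ∈ SemiDiscrete.rect c (9 * a) (9 * b) →
        |H δ k y| ≤ M) :
    SemiDiscrete.PrecompactOn δ₀ F (SemiDiscrete.rect c a b) := by
  open SemiDiscrete in
  obtain ⟨M, hM⟩ := hbdd
  obtain ⟨C, hC0, hC⟩ := exists_obs_bound ha hb M
  intro s hs hlim
  have hlim' : Tendsto s atTop (𝓝[>] 0) :=
    tendsto_nhdsWithin_iff.2 ⟨hlim, Eventually.of_forall fun n => (hs n).1⟩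
  -- Rounding recovers the column index from the real part, so each `F (s n)` is read as a function
  -- on `ℂ`.
  have hround : ∀ n (k : ℤ) (y : ℝ), F (s n) (round (2 * (pt (s n) k y).re / s n)) (pt (s n) k y).im
      = F (s n) k y := by
    intro n k y
    have h0 : s n ≠ 0 := (hs n).1.ne'
    have : 2 * (pt (s n) k y).re / s n = k := by simp only [pt]; field_simp
    rw [this, round_intCast]
    rfl
  have hev : ∀ᶠ n in atTop, LipschitzOnWith ⟨4 * C, by positivity⟩
      (fun z : ℂ => F (s n) (round (2 * z.re / s n)) z.im) (rect c a b ∩ medialLattice (s n)) ∧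
      ∀ p ∈ rect c a b ∩ medialLattice (s n),
        ‖F (s n) (round (2 * p.re / s n)) p.im‖ ≤ 2 * C := by
    have hmin : 0 < min a b / 400 := by have := lt_min ha hb; positivity
    filter_upwards [hlim'.eventually (hD.exhausts _ hQ (isCompact_rect _ _ _)),
      hlim.eventually (ge_mem_nhds hmin)] with n hn hδ
    obtain ⟨h0, h1⟩ := hs n
    have hFn := hF _ h0 h1
    have hbound := hC (s n) (D (s n)) (F (s n)) (H (s n)) c h0 hδ hFn (hH _ h0 h1) hn
      fun k y hp => hM _ h0 h1 k y (hn hp) hp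
    have hU : rect c (2 * a) (2 * b) ⊆ D (s n) := fun z hz =>
      hn ⟨hz.1.trans (by linarith), hz.2.trans (by linarith)⟩
    have hδa : s n ≤ a := by have := min_le_left a b; linarith
    constructor
    · refine LipschitzOnWith.of_dist_le_mul ?_
      rintro _ ⟨hp, k, y, rfl⟩ _ ⟨hp', k', y', rfl⟩
      rw [hround, hround, dist_eq_norm]
      exact hFn.norm_sub_le h0 hδa hC0 hb.le hU (fun k y h => (hbound k y h).2) hp hp'
    · rintro _ ⟨hp, k, y, rfl⟩
      rw [hround]
      have h2 : pt (s n) k y ∈ rect c (2 * a) (2 * b) :=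
        ⟨hp.1.trans (by linarith), hp.2.trans (by linarith)⟩
      have h3 : pt (s n) (k - 1) y ∈ rect c (2 * a) (2 * b) := by
        rw [pt_mem_rect] at hp h2 ⊢
        refine ⟨?_, h2.2⟩
        push_cast
        rw [abs_le] at *
        obtain ⟨⟨p1, p2⟩, -⟩ := hp
        constructor <;> linarith
      exact hFn.norm_le (hU h2) (hU h3) (hbound _ _ h2).1 (hbound _ _ h3).1
  obtain ⟨φ, f, hφ, hfc, hf⟩ := exists_subseq_tendsto_uniformly (isCompact_rect c a b)
    (fun n => inter_subset_left) hev
  refine ⟨φ, f, hφ, hfc, fun ε hε => ?_⟩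
  filter_upwards [hf ε hε] with n hn k y hp
  have := hn _ ⟨hp, k, y, rfl⟩
  rwa [hround] at this
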